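/- Let $K$ be an algebraically closed field and let $\varGamma$ be the quiver with four vertices $e_0,e_1,e_2,e_3$ and eight arrows $a_{l,m}\colon e_m\to e_{m+1}$ ($l\in\mathbb{Z}/2$, $m\in\mathbb{Z}/4$, indices of vertices taken modulo $4$). Write paths from left to right, and put $x_l:=\sum_{m=0}^{3}a_{l,m}\in K\varGamma$, the subscript $l$ of $x_l$ being taken modulo $2$. Let $q_0,q_1,q_2,q_3\in K\setminus\{0\}$ be such that the product $q_0q_1q_2q_3$ is not a root of unity, and let $$A=A_0(q_0,q_1,q_2,q_3):=K\varGamma\big/\big\langle x_0x_1,\ x_1x_0,\ e_i(q_ix_i^{2}+x_{i+1}^{2})\ \big|\ 0\le i\le 3\big\rangle .$$ Let $\mathrm{HH}^*(A)=\bigoplus_{n\ge0}\mathrm{Ext}^n_{A^{\mathrm e}}(A,A)$, where $A^{\mathrm e}=A^{\mathrm{op}}\otimes_K A$, be the Hochschild cohomology ring of $A$ with the Yoneda product, and let $\mathcal{N}_A$ be the ideal of $\mathrm{HH}^*(A)$ generated by all homogeneous nilpotent elements. Then $\mathrm{HH}^*(A)$ is a local $K$-algebra of dimension $4$ over $K$,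 and $\mathrm{HH}^*(A)/\mathcal{N}_A$ is isomorphic to $K$ as a $K$-algebra. -/

import Mathlib

open scoped TensorProduct DirectSum

universe u

/-! ### Path algebras -/

/-- The paths of a quiver, of arbitrary origin and terminus (the path `p` from `a` to `b` is the
triple `⟨a, b, p⟩`). -/
abbrev QuiverPath (V : Type*) [Quiver V] : Type _ := Σ a b : V, Quiver.Path a b

/-- The path algebra `KΓ` of a quiver with vertex type `V`: the vector space on the set of paths.
Paths are written from left to right. -/
def PathAlgebra (K : Type*) (V : Type*) [Quiver V] [Field K] : Type _ := QuiverPath V →₀ K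

namespace PathAlgebra

noncomputable section

variable {K V : Type*} [Quiver V] [Field K]

instance : AddCommGroup (PathAlgebra K V) := inferInstanceAs (AddCommGroup (QuiverPath V →₀ K))

instance : Module K (PathAlgebra K V) := inferInstanceAs (Module K (QuiverPath V →₀ K))

/-- The element of the path algebra given by a path. -/
def ofPath (K : Type*) [Field K] {V : Type*} [Quiver V] (p : QuiverPath V) : PathAlgebra K V :=
  Finsupp.single p (1 : K)

@[elab_as_elim]
theorem induction {P : PathAlgebra K V → Prop} (x : PathAlgebra K V) (zero : P 0)
    (add : ∀ x y, P x → P y → P (x + y)) (smul : ∀ (c : K) p, P (c • ofPath K p)) : P x := by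
  refine Finsupp.induction_linear (motive := P) x zero add fun p c => ?_
  have h : (Finsupp.single p c : QuiverPath V →₀ K) = c • Finsupp.single p (1 : K) := by simp
  rw [h]
  exact smul c p

open Classical in
/-- The product of two paths: the concatenation `pq` if `p` ends where `q` starts, otherwise `0`. -/
def mulPath (K : Type*) [Field K] {V : Type*} [Quiver V] (p q : QuiverPath V) :
    PathAlgebra K V :=
  if h : p.2.1 = q.1 then ofPath K ⟨p.1, q.2.1, p.2.2.comp (q.2.2.cast h.symm rfl)⟩ else 0

/-- The linear extension of a function on paths. -/
def extend {M : Type*} [AddCommGroup M] [Module K M] (f : QuiverPath V → M) :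
    PathAlgebra K V →ₗ[K] M :=
  Finsupp.lift M K (QuiverPath V) f

theorem extend_ofPath {M : Type*} [AddCommGroup M] [Module K M] (f : QuiverPath V → M)
    (p : QuiverPath V) : extend (K := K) f (ofPath K p) = f p := by
  have h : Finsupp.lift M K (QuiverPath V) f (Finsupp.single p 1) = f p := by simp
  exact h

/-- The multiplication of the path algebra, the bilinear extension of `mulPath`. -/
def mulLin (K : Type*) [Field K] (V : Type*) [Quiver V] :
    PathAlgebra K V →ₗ[K] PathAlgebra K V →ₗ[K] PathAlgebra K V :=
  extend fun p => extend fun q => mulPath K p q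

instance : Mul (PathAlgebra K V) := ⟨fun x y => mulLin K V x y⟩

theorem mul_def (x y : PathAlgebra K V) : x * y = mulLin K V x y := rfl

theorem ofPath_mul_ofPath (p q : QuiverPath V) :
    ofPath K p * ofPath K q = mulPath K p q := by
  rw [mul_def, mulLin, extend_ofPath, extend_ofPath]

theorem mulPath_of_eq {a b c : V} (p : Quiver.Path a b) (q : Quiver.Path b c) :
    mulPath K ⟨a, b, p⟩ ⟨b, c, q⟩ = ofPath K ⟨a, c, p.comp q⟩ := by
  simp [mulPath]

theorem mulPath_of_ne {p q : QuiverPath V} (h : p.2.1 ≠ q.1) : mulPath K p q = 0 := by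
  simp [mulPath, h]

/-- The trivial path `e_v` at the vertex `v`. -/
def vertex (K : Type*) [Field K] {V : Type*} [Quiver V] (v : V) : PathAlgebra K V :=
  ofPath K ⟨v, v, Quiver.Path.nil⟩

/-- An arrow, regarded as an element of the path algebra. -/
def arrow (K : Type*) [Field K] {V : Type*} [Quiver V] {v w : V} (a : v ⟶ w) : PathAlgebra K V :=
  ofPath K ⟨v, w, a.toPath⟩

instance [Fintype V] : One (PathAlgebra K V) := ⟨∑ v : V, vertex K v⟩

theorem one_def [Fintype V] : (1 : PathAlgebra K V) = ∑ v : V, vertex K v := rfl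

instance : Distrib (PathAlgebra K V) where
  left_distrib x y z := by simp [mul_def]
  right_distrib x y z := by simp [mul_def]

instance : NonUnitalNonAssocRing (PathAlgebra K V) where
  zero_mul x := by simp [mul_def]
  mul_zero x := by simp [mul_def]

theorem smul_mul (c : K) (x y : PathAlgebra K V) : c • x * y = c • (x * y) := by
  simp [mul_def]

theorem mul_smul' (c : K) (x y : PathAlgebra K V) : x * c • y = c • (x * y) := by
  simp [mul_def]

theorem ofPath_mul_assoc (p q r : QuiverPath V) :
    ofPath K p * ofPath K q * ofPath K r = ofPath K p * (ofPath K q * ofPath K r) := by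
  obtain ⟨a, b, p⟩ := p
  obtain ⟨c, d, q⟩ := q
  obtain ⟨e, f, r⟩ := r
  simp only [ofPath_mul_ofPath]
  by_cases h₁ : b = c
  · subst h₁
    by_cases h₂ : d = e
    · subst h₂
      simp only [mulPath_of_eq, ofPath_mul_ofPath, Quiver.Path.comp_assoc]
    · rw [mulPath_of_eq, ofPath_mul_ofPath, mulPath_of_ne h₂, mulPath_of_ne h₂, mul_zero]
  · rw [mulPath_of_ne (p := ⟨a, b, p⟩) (q := ⟨c, d, q⟩) h₁, zero_mul]
    by_cases h₂ : d = e
    · subst h₂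
      rw [mulPath_of_eq, ofPath_mul_ofPath, mulPath_of_ne h₁]
    · rw [mulPath_of_ne h₂, mul_zero]

theorem mul_assoc' (x y z : PathAlgebra K V) : x * y * z = x * (y * z) := by
  refine induction x (by simp) (fun x₁ x₂ h₁ h₂ => by simp only [add_mul, h₁, h₂]) fun a p => ?_
  refine induction y (by simp) (fun x₁ x₂ h₁ h₂ => by simp only [add_mul, mul_add, h₁, h₂])
    fun b q => ?_
  refine induction z (by simp) (fun x₁ x₂ h₁ h₂ => by simp only [mul_add, h₁, h₂]) fun c r => ?_
  simp only [smul_mul, mul_smul', ofPath_mul_assoc]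

variable [Fintype V]

theorem one_mul' (x : PathAlgebra K V) : 1 * x = x := by
  classical
  refine induction x (by simp) (fun x₁ x₂ h₁ h₂ => by simp only [mul_add, h₁, h₂]) fun c p => ?_
  obtain ⟨a, b, p⟩ := p
  rw [mul_smul', one_def, Finset.sum_mul, Finset.sum_eq_single a]
  · rw [vertex, ofPath_mul_ofPath, mulPath_of_eq, Quiver.Path.nil_comp]
  · intro v _ hv
    rw [vertex, ofPath_mul_ofPath, mulPath_of_ne hv]
  · simp

theorem mul_one' (x : PathAlgebra K V) : x * 1 = x := by
  classical
  refine induction x (by simp) (fun x₁ x₂ h₁ h₂ => by simp only [add_mul, h₁, h₂]) fun c p => ?_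
  obtain ⟨a, b, p⟩ := p
  rw [smul_mul, one_def, Finset.mul_sum, Finset.sum_eq_single b]
  · rw [vertex, ofPath_mul_ofPath, mulPath_of_eq, Quiver.Path.comp_nil]
  · intro v _ hv
    rw [vertex, ofPath_mul_ofPath, mulPath_of_ne (Ne.symm hv)]
  · simp

instance : Ring (PathAlgebra K V) where
  __ := (inferInstance : NonUnitalNonAssocRing (PathAlgebra K V))
  mul_assoc := mul_assoc'
  one_mul := one_mul'
  mul_one := mul_one'

instance : Algebra K (PathAlgebra K V) := Algebra.ofModule smul_mul mul_smul'

end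

end PathAlgebra

/-! ### The algebra `A_T(q₀, q₁, q₂, q₃)` -/

/-- The vertices `e_0, e_1, e_2, e_3` of the quiver `Γ`, indexed modulo `4`. -/
def GammaVertex : Type := ZMod 4

namespace GammaVertex

instance : CommRing GammaVertex := inferInstanceAs (CommRing (ZMod 4))

instance : Fintype GammaVertex := inferInstanceAs (Fintype (ZMod 4))

instance : DecidableEq GammaVertex := inferInstanceAs (DecidableEq (ZMod 4))

/-- The class modulo `2` of an index modulo `4`. -/
def mod2 (i : GammaVertex) : ZMod 2 := ZMod.castHom (by norm_num : 2 ∣ 4) (ZMod 2) i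

end GammaVertex

/-- The arrows of `Γ`: for `l` modulo `2` and `m` modulo `4` an arrow `a_{l,m}` from `e_m` to
`e_{m+1}`, and no others. -/
inductive GammaArrow : GammaVertex → GammaVertex → Type
  | a (l : ZMod 2) (m : GammaVertex) : GammaArrow m (m + 1)

instance : Quiver GammaVertex := ⟨GammaArrow⟩

noncomputable section

/-- The idempotent `e_i` of `KΓ`. -/
abbrev gammaE (K : Type u) [Field K] (i : GammaVertex) : PathAlgebra K GammaVertex :=
  PathAlgebra.vertex K i

/-- The element `x_l = ∑_m a_{l,m}` of `KΓ`. -/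
def gammaX (K : Type u) [Field K] (l : ZMod 2) : PathAlgebra K GammaVertex :=
  ∑ m : GammaVertex, PathAlgebra.arrow K (V := GammaVertex) (w := m + 1) (GammaArrow.a l m)

/-- The generators `x_l x_{l+1}` and `e_i (q_i x_i^{4T+2} + x_{i+1}^{4T+2})` of the ideal
`I_T(q₀, q₁, q₂, q₃)`. -/
def gammaRelations {K : Type u} [Field K] (T : ℕ) (q : GammaVertex → K) :
    Set (PathAlgebra K GammaVertex) :=
  {r | ∃ l : ZMod 2, r = gammaX K l * gammaX K (l + 1)} ∪
  {r | ∃ i : GammaVertex, r = gammaE K i *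
    (q i • gammaX K i.mod2 ^ (4 * T + 2) + gammaX K (i.mod2 + 1) ^ (4 * T + 2))}

/-- The algebra `A_T(q₀, q₁, q₂, q₃) = KΓ / I_T(q₀, q₁, q₂, q₃)`. -/
abbrev GammaAlgebra {K : Type u} [Field K] (T : ℕ) (q : GammaVertex → K) : Type u :=
  (TwoSidedIdeal.span (gammaRelations T q)).ringCon.Quotient

end

/-! ### The Hochschild cohomology ring -/

section Hochschild

open CategoryTheory CategoryTheory.Abelian

noncomputable section

variable (K : Type u) [Field K] (A : Type u) [Ring A] [Algebra K A]

/-- `A` as an `A`-`A`-bimodule, that is, as a left module over `A ⊗ Aᵒᵖ` (equivalently, as a right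
module over the enveloping algebra `Aᵒᵖ ⊗ A`); `a ⊗ b` acts by `x ↦ a x b`. -/
def regularBimodule : ModuleCat.{u} (A ⊗[K] Aᵐᵒᵖ) :=
  letI := instModuleTensorProductMop K A
  ModuleCat.of (A ⊗[K] Aᵐᵒᵖ) A

/-- The Hochschild cohomology group `HHⁿ(A) = Extⁿ(A, A)` over the enveloping algebra. -/
def HochschildCohomology (n : ℕ) : Type u :=
  Ext.{u} (regularBimodule K A) (regularBimodule K A) n

namespace HochschildCohomology

instance (n : ℕ) : AddCommGroup (HochschildCohomology K A n) :=
  inferInstanceAs (AddCommGroup (Ext.{u} (regularBimodule K A) (regularBimodule K A) n))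

instance (n : ℕ) : Module K (HochschildCohomology K A n) :=
  inferInstanceAs (Module K (Ext.{u} (regularBimodule K A) (regularBimodule K A) n))

variable {K A}

/-- The Yoneda product. -/
def yoneda {m n : ℕ} (α : HochschildCohomology K A m) (β : HochschildCohomology K A n) :
    HochschildCohomology K A (m + n) :=
  Ext.comp (X := regularBimodule K A) (Y := regularBimodule K A) (Z := regularBimodule K A)
    α β rfl

variable (K A) in
/-- The identity of `A`, as an element of `HH⁰(A)`. -/
def unit : HochschildCohomology K A 0 := Ext.mk₀ (𝟙 (regularBimodule K A))

variable (K A) in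
/-- The unit map `K → HH⁰(A)`. -/
def ofScalar : K →+ HochschildCohomology K A 0 where
  toFun c := c • unit K A
  map_zero' := zero_smul _ _
  map_add' _ _ := add_smul _ _ _

theorem yoneda_assoc {l m n : ℕ} (α : HochschildCohomology K A l)
    (β : HochschildCohomology K A m) (γ : HochschildCohomology K A n) :
    GradedMonoid.mk (l + m + n) (yoneda (yoneda α β) γ) =
      GradedMonoid.mk (l + (m + n)) (yoneda α (yoneda β γ)) := by
  have key : ∀ (k : ℕ) (h : l + m + n = k),
      GradedMonoid.mk (A := HochschildCohomology K A) (l + m + n) (yoneda (yoneda α β) γ) =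
        GradedMonoid.mk k (Ext.comp (X := regularBimodule K A) (Y := regularBimodule K A)
          (Z := regularBimodule K A) α (yoneda β γ) ((add_assoc l m n).symm.trans h)) := by
    rintro _ rfl
    exact congrArg _ (Ext.comp_assoc (X := regularBimodule K A) (Y := regularBimodule K A)
      (Z := regularBimodule K A) (T := regularBimodule K A) α β γ rfl rfl rfl)
  exact key _ (add_assoc l m n)

theorem unit_yoneda {n : ℕ} (α : HochschildCohomology K A n) :
    GradedMonoid.mk (0 + n) (yoneda (unit K A) α) = GradedMonoid.mk n α := by
  have key : ∀ (k : ℕ) (h : 0 + n = k),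
      GradedMonoid.mk (A := HochschildCohomology K A) (0 + n) (yoneda (unit K A) α) =
        GradedMonoid.mk k (Ext.comp (X := regularBimodule K A) (Y := regularBimodule K A)
          (Z := regularBimodule K A) (unit K A) α h) := by
    rintro _ rfl
    rfl
  exact (key n (zero_add n)).trans (congrArg _ (Ext.mk₀_id_comp (X := regularBimodule K A)
    (Y := regularBimodule K A) α))

theorem yoneda_unit {n : ℕ} (α : HochschildCohomology K A n) :
    GradedMonoid.mk (n + 0) (yoneda α (unit K A)) = GradedMonoid.mk n α :=
  congrArg _ (Ext.comp_mk₀_id (X := regularBimodule K A) (Y := regularBimodule K A) α)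

theorem smul_yoneda {m n : ℕ} (c : K) (α : HochschildCohomology K A m)
    (β : HochschildCohomology K A n) : yoneda (c • α) β = c • yoneda α β :=
  Ext.smul_comp (X := regularBimodule K A) (Y := regularBimodule K A)
    (Z := regularBimodule K A) α β rfl c

theorem yoneda_smul {m n : ℕ} (c : K) (α : HochschildCohomology K A m)
    (β : HochschildCohomology K A n) : yoneda α (c • β) = c • yoneda α β :=
  Ext.comp_smul (X := regularBimodule K A) (Y := regularBimodule K A)
    (Z := regularBimodule K A) α β rfl c

instance : GradedMonoid.GMul (HochschildCohomology K A) := ⟨yoneda⟩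

instance : GradedMonoid.GOne (HochschildCohomology K A) := ⟨unit K A⟩

instance : GradedMonoid.GMonoid (HochschildCohomology K A) where
  one_mul := fun ⟨_, α⟩ => unit_yoneda α
  mul_one := fun ⟨_, α⟩ => yoneda_unit α
  mul_assoc := fun ⟨_, α⟩ ⟨_, β⟩ ⟨_, γ⟩ => yoneda_assoc α β γ

instance : DirectSum.GRing (HochschildCohomology K A) where
  mul_zero {_ j} α := Ext.comp_zero (X := regularBimodule K A) (Y := regularBimodule K A)
    α (regularBimodule K A) j _ rfl
  zero_mul {i _} β := Ext.zero_comp (regularBimodule K A) (Y := regularBimodule K A)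
    (Z := regularBimodule K A) i β _ rfl
  mul_add α β γ := Ext.comp_add (X := regularBimodule K A) (Y := regularBimodule K A)
    (Z := regularBimodule K A) α β γ rfl
  add_mul α β γ := Ext.add_comp (X := regularBimodule K A) (Y := regularBimodule K A)
    (Z := regularBimodule K A) α β γ rfl
  natCast n := n • unit K A
  natCast_zero := zero_nsmul _
  natCast_succ n := succ_nsmul _ n
  intCast n := n • unit K A
  intCast_ofNat n := natCast_zsmul _ n
  intCast_negSucc_ofNat n := negSucc_zsmul _ n

theorem mk_smul {m n : ℕ} (c : K) {α : HochschildCohomology K A m}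
    {β : HochschildCohomology K A n} (h : GradedMonoid.mk m α = GradedMonoid.mk n β) :
    GradedMonoid.mk m (c • α) = GradedMonoid.mk n (c • β) :=
  congrArg (fun x : GradedMonoid (HochschildCohomology K A) => GradedMonoid.mk x.1 (c • x.2)) h

instance : DirectSum.GAlgebra K (HochschildCohomology K A) where
  toFun := ofScalar K A
  map_one := one_smul _ _
  map_mul r s := by
    change GradedMonoid.mk _ ((r * s) • unit K A) =
      GradedMonoid.mk _ (yoneda (r • unit K A) (s • unit K A))
    rw [smul_yoneda, yoneda_smul, smul_smul]
    exact mk_smul _ (yoneda_unit _).symm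
  commutes := fun r ⟨n, α⟩ => by
    change GradedMonoid.mk _ (yoneda (r • unit K A) α) =
      GradedMonoid.mk _ (yoneda α (r • unit K A))
    rw [smul_yoneda, yoneda_smul]
    exact mk_smul r ((unit_yoneda α).trans (yoneda_unit α).symm)
  smul_def := fun r ⟨n, α⟩ => by
    change GradedMonoid.mk _ (r • α) = GradedMonoid.mk _ (yoneda (r • unit K A) α)
    rw [smul_yoneda]
    exact mk_smul r (unit_yoneda α).symm

end HochschildCohomology

/-- The Hochschild cohomology ring `HH*(A) = ⨁ₙ HHⁿ(A)` with the Yoneda product, a graded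
`K`-algebra. -/
abbrev HochschildRing : Type u := ⨁ n : ℕ, HochschildCohomology K A n

/-- The (two-sided) ideal of `HH*(A)` generated by all homogeneous nilpotent elements. -/
def hochschildNilIdeal : TwoSidedIdeal (HochschildRing K A) :=
  TwoSidedIdeal.span {x | IsNilpotent x ∧
    ∃ (n : ℕ) (α : HochschildCohomology K A n), x = DirectSum.of (HochschildCohomology K A) n α}

end

end Hochschild

/-! ### Cyclic covers of the quantum exterior algebra -/

/-! At each vertex one of the two arrows is assigned to `u`, rescaled by a scalar `c i`, and the
other to `v`, the labels alternating along the cycle. The relations become u² = v² = 0 and vu = -ρ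
uv, where ρ⁴ = q₀q₁q₂q₃; this fourth power is what lets the scalars `c i` close up around the cycle
(`exists_rescaling`). So A is a ℤ/4-cover of a quantum exterior algebra, with basis e_i, e_i u, e_i
v, e_i uv, whose independence is certified by a matrix representation (`quantumCover`).

Such an algebra has a Koszul bimodule resolution: in degree n there is one generator for each
u^(n-b) v^b with 0 ≤ b ≤ n, contributing the summands A e_i ⊗ e_{i+n} A (`freeD_homotopy`,
`koszulD_exact`, `koszulD_exact_zero`). An n-cochain is therefore a family of n+1 elements of ⊕ e_i
A e_{i+n}. Since A has degrees 0, 1, 2 only, its components are f_b, p_b u + r_b v, w_b uv or 0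
according as n ≡ 0, 1, 2, 3 mod 4, where f, p, r, w are functions on ℤ/4. With S the cyclic shift,
the codifferential acts through operators ρ^i S - ρ^j. As S⁴ = 1, these are invertible whenever
ρ^(4i) ≠ ρ^(4j), which here means i ≠ j (`twistedDiff_injective`).

For n divisible by 4, the complex in degrees n, n+1, n+2 splits into two isolated isomorphisms, r_0
→ w_0 and p_(n+1) → w_(n+2), and for each 0 ≤ b ≤ n a square f_b → (p_b, r_(b+1)) → w_(b+1). Up to
scalars and signs this square is the Koszul complex of the commuting operators ρ^b S - 1 and S -
ρ^(n-b), which is exact as soon as one of them is invertible (`exists_twistedDiff_eq`). Both are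
singular only for b = 0 = n. The remaining square is that of S - 1 taken twice, whose kernel and
cokernel are one-dimensional; it gives dimensions 1, 2, 1 in degrees 0, 1, 2, and nothing survives
above.

Finally HH⁰ = K and products of three elements of positive degree vanish. Every element is thus a
scalar plus a nilpotent, so the ring is local, and the homogeneous nilpotents generate the positive
part, with quotient K. -/

/-- The data exhibiting `A` as the `ZMod 4`-cover of the quantum exterior algebra
`K⟨u, v⟩ / (u², v², vu + ρ uv)` in two generators of degree one. -/
structure QuantumCover (K A : Type*) [Field K] [Ring A] [Algebra K A] (ρ : K) where
  /-- The orthogonal idempotents. -/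
  e : ZMod 4 → A
  /-- The first generator. -/
  u : A
  /-- The second generator. -/
  v : A
  /-- The monomial basis. -/
  basis : Module.Basis (ZMod 4 × Fin 4) K A
  e_mul_e : ∀ i j, e i * e j = if i = j then e i else 0
  sum_e : ∑ i, e i = 1
  e_mul_u : ∀ i, e i * u = u * e (i + 1)
  e_mul_v : ∀ i, e i * v = v * e (i + 1)
  u_mul_u : u * u = 0
  v_mul_v : v * v = 0
  v_mul_u : v * u = -(ρ • (u * v))
  basis_apply : ∀ i m, basis (i, m) = e i * (![1, u, v, u * v] : Fin 4 → A) m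

namespace QuantumCover

noncomputable section

open MulOpposite

variable {K A : Type*} [Field K] [Ring A] [Algebra K A] {ρ : K} (S : QuantumCover K A ρ)

theorem basis_zero (i : ZMod 4) : S.basis (i, 0) = S.e i := by simp [S.basis_apply]

theorem basis_one (i : ZMod 4) : S.basis (i, 1) = S.e i * S.u := by simp [S.basis_apply]

theorem basis_two (i : ZMod 4) : S.basis (i, 2) = S.e i * S.v := by simp [S.basis_apply]

theorem basis_three (i : ZMod 4) : S.basis (i, 3) = S.e i * (S.u * S.v) := by
  simp [S.basis_apply]

/-- The coordinates of an element along the `m`-th monomial. -/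
def coord (m : Fin 4) : A →ₗ[K] (ZMod 4 → K) :=
  LinearMap.pi fun i => S.basis.coord (i, m)

theorem coord_apply (m : Fin 4) (a : A) (i : ZMod 4) :
    S.coord m a i = S.basis.repr a (i, m) := rfl

theorem coord_ext {M : Type*} [AddCommGroup M] [Module K M] {f g : A →ₗ[K] M}
    (h₀ : ∀ i, f (S.e i) = g (S.e i)) (h₁ : ∀ i, f (S.e i * S.u) = g (S.e i * S.u))
    (h₂ : ∀ i, f (S.e i * S.v) = g (S.e i * S.v))
    (h₃ : ∀ i, f (S.e i * (S.u * S.v)) = g (S.e i * (S.u * S.v))) : f = g := by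
  refine S.basis.ext ?_
  rintro ⟨i, m⟩
  fin_cases m
  · simpa [S.basis_apply] using h₀ i
  · simpa [S.basis_apply] using h₁ i
  · simpa [S.basis_apply] using h₂ i
  · simpa [S.basis_apply] using h₃ i

theorem coord_monomial (m m' : Fin 4) (i : ZMod 4) :
    S.coord m (S.basis (i, m')) = if m = m' then Pi.single i 1 else 0 := by
  ext j
  rw [coord_apply, Module.Basis.repr_self, Finsupp.single_apply]
  by_cases h : m = m'
  · subst h
    by_cases hj : i = j
    · subst hj; simp
    · simp [hj, Ne.symm hj]
  · simp [h, Ne.symm h]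

theorem coord_e (m : Fin 4) (i : ZMod 4) :
    S.coord m (S.e i) = if m = 0 then Pi.single i 1 else 0 := by
  rw [← basis_zero, coord_monomial]

theorem coord_e_mul_u (m : Fin 4) (i : ZMod 4) :
    S.coord m (S.e i * S.u) = if m = 1 then Pi.single i 1 else 0 := by
  rw [← basis_one, coord_monomial]

theorem coord_e_mul_v (m : Fin 4) (i : ZMod 4) :
    S.coord m (S.e i * S.v) = if m = 2 then Pi.single i 1 else 0 := by
  rw [← basis_two, coord_monomial]

theorem coord_e_mul_uv (m : Fin 4) (i : ZMod 4) :
    S.coord m (S.e i * (S.u * S.v)) = if m = 3 then Pi.single i 1 else 0 := by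
  rw [← basis_three, coord_monomial]

theorem uv_mul_u : S.u * S.v * S.u = 0 := by
  rw [mul_assoc, S.v_mul_u, mul_neg, mul_smul_comm, ← mul_assoc, S.u_mul_u]; simp

theorem uv_mul_v : S.u * S.v * S.v = 0 := by
  rw [mul_assoc, S.v_mul_v, mul_zero]

/-- The effect on coordinates of right multiplication by `u`. -/
theorem coord_mul_u (m : Fin 4) (a : A) : S.coord m (a * S.u) =
    (![0, S.coord 0 a, 0, -(ρ • S.coord 2 a)] : Fin 4 → ZMod 4 → K) m := by
  let f : A →ₗ[K] (Fin 4 → ZMod 4 → K) := LinearMap.pi fun m =>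
    (S.coord m).comp (LinearMap.mulRight K S.u)
  let g : A →ₗ[K] (Fin 4 → ZMod 4 → K) :=
    LinearMap.pi ![0, S.coord 0, 0, -(ρ • S.coord 2)]
  have h : f = g := by
    refine S.coord_ext ?_ ?_ ?_ ?_ <;> intro i <;> funext m
    · fin_cases m <;> simp [f, g, coord_e_mul_u, coord_e]
    · fin_cases m <;> simp [f, g, mul_assoc, S.u_mul_u, coord_e_mul_u]
    · fin_cases m <;> simp [f, g, mul_assoc, S.v_mul_u, coord_e_mul_v, coord_e_mul_uv]
    · fin_cases m <;> simp [f, g, mul_assoc (S.e i), S.uv_mul_u, coord_e_mul_uv]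
  have := congrFun (LinearMap.congr_fun h a) m
  fin_cases m <;> simpa [f, g] using this

/-- The effect on coordinates of right multiplication by `v`. -/
theorem coord_mul_v (m : Fin 4) (a : A) : S.coord m (a * S.v) =
    (![0, 0, S.coord 0 a, S.coord 1 a] : Fin 4 → ZMod 4 → K) m := by
  let f : A →ₗ[K] (Fin 4 → ZMod 4 → K) := LinearMap.pi fun m =>
    (S.coord m).comp (LinearMap.mulRight K S.v)
  let g : A →ₗ[K] (Fin 4 → ZMod 4 → K) := LinearMap.pi ![0, 0, S.coord 0, S.coord 1]
  have h : f = g := by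
    refine S.coord_ext ?_ ?_ ?_ ?_ <;> intro i <;> funext m
    · fin_cases m <;> simp [f, g, coord_e_mul_v, coord_e]
    · fin_cases m <;> simp [f, g, mul_assoc, coord_e_mul_u, coord_e_mul_uv]
    · fin_cases m <;> simp [f, g, mul_assoc, S.v_mul_v, coord_e_mul_v]
    · fin_cases m <;> simp [f, g, mul_assoc (S.e i), S.uv_mul_v, coord_e_mul_uv]
  have := congrFun (LinearMap.congr_fun h a) m
  fin_cases m <;> simpa [f, g] using this

/-! #### The enveloping algebra -/

/-- Left multiplication by `a`, in the enveloping algebra. -/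
def lft (K : Type*) {A : Type*} [Field K] [Ring A] [Algebra K A] (a : A) : A ⊗[K] Aᵐᵒᵖ :=
  a ⊗ₜ 1

/-- Right multiplication by `a`, in the enveloping algebra. -/
def rgt (K : Type*) {A : Type*} [Field K] [Ring A] [Algebra K A] (a : A) : A ⊗[K] Aᵐᵒᵖ :=
  1 ⊗ₜ op a

/-- The coordinates in the enveloping algebra along the `m`-th monomial of the left factor. -/
def envCoord (m : Fin 4) : A ⊗[K] Aᵐᵒᵖ →ₗ[K] (ZMod 4 → A) :=
  TensorProduct.lift (LinearMap.mk₂ K (fun a w i => S.coord m a i • unop w)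
    (fun a b w => by ext i; simp [add_smul]) (fun c a w => by ext i; simp [smul_smul])
    (fun a w w' => by ext i; simp) (fun c a w => by ext i; exact smul_comm _ _ _))

theorem envCoord_tmul (m : Fin 4) (a : A) (w : Aᵐᵒᵖ) :
    S.envCoord m (a ⊗ₜ w) = fun i => S.coord m a i • unop w := rfl

theorem envCoord_mul_rgt (m : Fin 4) (a : A) (x : A ⊗[K] Aᵐᵒᵖ) :
    S.envCoord m (x * rgt K a) = a • S.envCoord m x := by
  induction x with
  | zero => simp
  | add x y hx hy => simp [add_mul, hx, hy]
  | tmul b w =>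
    rw [rgt, Algebra.TensorProduct.tmul_mul_tmul, envCoord_tmul, envCoord_tmul]
    ext i
    simp

theorem envCoord_mul_u (m : Fin 4) (x : A ⊗[K] Aᵐᵒᵖ) : S.envCoord m (x * lft K S.u) =
    (![0, S.envCoord 0 x, 0, -(ρ • S.envCoord 2 x)] : Fin 4 → ZMod 4 → A) m := by
  induction x with
  | zero => fin_cases m <;> simp
  | add x y hx hy =>
    rw [add_mul, map_add, hx, hy]
    fin_cases m <;> simp [add_comm]
  | tmul b w =>
    rw [lft, Algebra.TensorProduct.tmul_mul_tmul, envCoord_tmul, coord_mul_u]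
    ext i
    fin_cases m <;> simp [envCoord_tmul, smul_smul]

theorem envCoord_mul_v (m : Fin 4) (x : A ⊗[K] Aᵐᵒᵖ) : S.envCoord m (x * lft K S.v) =
    (![0, 0, S.envCoord 0 x, S.envCoord 1 x] : Fin 4 → ZMod 4 → A) m := by
  induction x with
  | zero => fin_cases m <;> simp
  | add x y hx hy =>
    rw [add_mul, map_add, hx, hy]
    fin_cases m <;> simp
  | tmul b w =>
    rw [lft, Algebra.TensorProduct.tmul_mul_tmul, envCoord_tmul, coord_mul_v]
    ext i
    fin_cases m <;> simp [envCoord_tmul]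

/-- The element of the enveloping algebra with given coordinates. -/
def envMk (X : Fin 4 → ZMod 4 → A) : A ⊗[K] Aᵐᵒᵖ :=
  ∑ p : ZMod 4 × Fin 4, S.basis p ⊗ₜ op (X p.2 p.1)

theorem envCoord_envMk (X : Fin 4 → ZMod 4 → A) (m : Fin 4) :
    S.envCoord m (S.envMk X) = X m := by
  ext i
  rw [envMk, map_sum, Finset.sum_apply, Finset.sum_eq_single (i, m)]
  · simp [envCoord_tmul, coord_apply]
  · rintro ⟨j, m'⟩ - h
    simp [envCoord_tmul, coord_apply, h]
  · simp

theorem envMk_envCoord (x : A ⊗[K] Aᵐᵒᵖ) : S.envMk (fun m => S.envCoord m x) = x := by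
  induction x with
  | zero => simp [envMk]
  | add x y hx hy =>
    conv_rhs => rw [← hx, ← hy]
    simp [envMk, ← Finset.sum_add_distrib, TensorProduct.tmul_add]
  | tmul b w =>
    conv_rhs => rw [← S.basis.sum_repr b, TensorProduct.sum_tmul]
    simp [envMk, envCoord_tmul, coord_apply, TensorProduct.smul_tmul]

theorem env_ext {x y : A ⊗[K] Aᵐᵒᵖ} (h : ∀ m, S.envCoord m x = S.envCoord m y) : x = y := by
  rw [← S.envMk_envCoord x, ← S.envMk_envCoord y]
  simp [h]

end

end QuantumCover

set_option linter.unusedSimpArgs false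

namespace QuantumCover

noncomputable section

open MulOpposite

variable {K A : Type*} [Field K] [Ring A] [Algebra K A] {ρ : K} (S : QuantumCover K A ρ)

/-! #### The Koszul bimodule complex -/

theorem lft_mul_lft (a b : A) : lft K a * lft K b = lft K (a * b) := by
  simp [lft, Algebra.TensorProduct.tmul_mul_tmul]

theorem rgt_mul_rgt (a b : A) : rgt K a * rgt K b = rgt K (b * a) := by
  simp [rgt, Algebra.TensorProduct.tmul_mul_tmul]

theorem rgt_mul_lft (a b : A) : rgt K a * lft K b = lft K b * rgt K a := by
  simp [lft, rgt, Algebra.TensorProduct.tmul_mul_tmul]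

/-- The coefficient of the differential that lowers the exponent of `u`. -/
def dU (n b : ℕ) : A ⊗[K] Aᵐᵒᵖ := ρ ^ b • lft K S.u + (-1 : K) ^ (n + 1) • rgt K S.u

/-- The coefficient of the differential that lowers the exponent of `v`. -/
def dV (n b : ℕ) : A ⊗[K] Aᵐᵒᵖ := lft K S.v + ((-1 : K) ^ (n + 1) * ρ ^ (n - b)) • rgt K S.v

/-- The differential of the Koszul complex, on free modules. -/
def freeD (n : ℕ) : (Fin (n + 2) → A ⊗[K] Aᵐᵒᵖ) →ₗ[A ⊗[K] Aᵐᵒᵖ] (Fin (n + 1) → A ⊗[K] Aᵐᵒᵖ) where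
  toFun x b := x b.castSucc * S.dU n b + x b.succ * S.dV n b
  map_add' x y := by ext b; simp only [Pi.add_apply, add_mul]; abel
  map_smul' r x := by ext b; simp [mul_add, mul_assoc]

theorem freeD_apply (n : ℕ) (x : Fin (n + 2) → A ⊗[K] Aᵐᵒᵖ) (b : Fin (n + 1)) :
    S.freeD n x b = x b.castSucc * S.dU n b + x b.succ * S.dV n b := rfl

/-- The squares vanish on both sides because u² = 0, and the two mixed terms cancel because the sign
alternates with the degree. -/
theorem dU_mul_dU (n b : ℕ) : S.dU (n + 1) b * S.dU n b = 0 := by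
  have h : lft K S.u * lft K S.u = 0 := by rw [lft_mul_lft, S.u_mul_u, lft, TensorProduct.zero_tmul]
  have h' : rgt K S.u * rgt K S.u = 0 := by
    rw [rgt_mul_rgt, S.u_mul_u, rgt, op_zero, TensorProduct.tmul_zero]
  simp only [dU, add_mul, mul_add, smul_mul_smul_comm, h, h', rgt_mul_lft, smul_zero, zero_add,
    add_zero, ← add_smul]
  rw [show (-1) ^ (n + 1 + 1) * ρ ^ b + ρ ^ b * (-1) ^ (n + 1) = 0 by ring, zero_smul]

theorem dV_mul_dV (n b : ℕ) : S.dV (n + 1) (b + 1) * S.dV n b = 0 := by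
  have h : lft K S.v * lft K S.v = 0 := by rw [lft_mul_lft, S.v_mul_v, lft, TensorProduct.zero_tmul]
  have h' : rgt K S.v * rgt K S.v = 0 := by
    rw [rgt_mul_rgt, S.v_mul_v, rgt, op_zero, TensorProduct.tmul_zero]
  simp only [dV, add_mul, mul_add, smul_mul_smul_comm, h, h', rgt_mul_lft, smul_zero, zero_add,
    add_zero, mul_smul_comm, smul_mul_assoc, ← add_smul, Nat.add_sub_add_right]
  rw [show (-1) ^ (n + 1 + 1) * ρ ^ (n - b) + (-1) ^ (n + 1) * ρ ^ (n - b) = 0 by ring, zero_smul]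

/-- The powers of ρ in `dU` and `dV` count the letters that the removed letter has to cross, so they
absorb the factor -ρ that vu = -ρ uv produces on either tensor factor. The bound `b ≤ n` gives n + 1
- b = (n - b) + 1 for truncated subtraction. -/
theorem dU_mul_dV (n b : ℕ) (hb : b ≤ n) :
    S.dU (n + 1) (b + 1) * S.dV n b + S.dV (n + 1) b * S.dU n b = 0 := by
  have h : lft K S.v * lft K S.u = -(ρ • (lft K S.u * lft K S.v)) := by
    simp [lft_mul_lft, S.v_mul_u, lft, TensorProduct.neg_tmul, TensorProduct.smul_tmul']
  have h' : rgt K S.u * rgt K S.v = -(ρ • (rgt K S.v * rgt K S.u)) := by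
    rw [rgt_mul_rgt, rgt_mul_rgt, S.v_mul_u, rgt, rgt, op_neg, op_smul, TensorProduct.tmul_neg,
      TensorProduct.tmul_smul]
  rw [show n + 1 = n - b + 1 + b by omega]
  obtain ⟨c, rfl⟩ := Nat.exists_eq_add_of_le hb
  simp only [dU, dV, add_mul, mul_add, smul_mul_smul_comm, mul_smul_comm, smul_mul_assoc, h, h',
    rgt_mul_lft, smul_neg, smul_smul, show b + c - b = c by omega,
    show c + 1 + b - b = c + 1 by omega]
  module

theorem freeD_freeD (n : ℕ) (x : Fin (n + 3) → A ⊗[K] Aᵐᵒᵖ) :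
    S.freeD n (S.freeD (n + 1) x) = 0 := by
  ext b
  have h₁ := S.dU_mul_dU n b
  have h₂ := S.dV_mul_dV n b
  have h₃ := S.dU_mul_dV n b (by omega)
  rw [freeD_apply, freeD_apply, freeD_apply]
  simp only [add_mul, mul_assoc, Fin.val_castSucc, Fin.val_succ, h₁, h₂, mul_zero, zero_add,
    add_zero, Fin.succ_castSucc, ← mul_add, Pi.zero_apply]
  rw [add_comm (S.dV _ _ * _), h₃, mul_zero]

/-! #### Exactness -/

/-- The action of `a` on coordinates, by left multiplication. -/
def leftMul (a : A) : (ZMod 4 → A) →ₗ[K] (ZMod 4 → A) :=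
  LinearMap.pi fun i => (LinearMap.mulLeft K a).comp (LinearMap.proj i)

theorem envCoord_mul_rgt' (m : Fin 4) (a : A) (x : A ⊗[K] Aᵐᵒᵖ) :
    S.envCoord m (x * rgt K a) = leftMul (K := K) a (S.envCoord m x) :=
  S.envCoord_mul_rgt m a x

theorem leftMul_leftMul (a b : A) (x : ZMod 4 → A) :
    leftMul (K := K) a (leftMul (K := K) b x) = leftMul (K := K) (a * b) x := by
  ext i; simp [leftMul, mul_assoc]

theorem envCoord_mul_dU (m : Fin 4) (n b : ℕ) (x : A ⊗[K] Aᵐᵒᵖ) :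
    S.envCoord m (x * S.dU n b) =
      ρ ^ b • (![0, S.envCoord 0 x, 0, -(ρ • S.envCoord 2 x)] : Fin 4 → ZMod 4 → A) m +
        (-1 : K) ^ (n + 1) • leftMul (K := K) S.u (S.envCoord m x) := by
  rw [dU, mul_add, mul_smul_comm, mul_smul_comm, map_add, map_smul, map_smul, envCoord_mul_u,
    envCoord_mul_rgt']

theorem envCoord_mul_dV (m : Fin 4) (n b : ℕ) (x : A ⊗[K] Aᵐᵒᵖ) :
    S.envCoord m (x * S.dV n b) =
      (![0, 0, S.envCoord 0 x, S.envCoord 1 x] : Fin 4 → ZMod 4 → A) m +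
        ((-1 : K) ^ (n + 1) * ρ ^ (n - b)) • leftMul (K := K) S.v (S.envCoord m x) := by
  rw [dV, mul_add, mul_smul_comm, map_add, map_smul, envCoord_mul_v, envCoord_mul_rgt']

/-- The contracting homotopy of the Koszul complex. -/
def homotopy (n : ℕ) (x : Fin (n + 1) → A ⊗[K] Aᵐᵒᵖ) : Fin (n + 2) → A ⊗[K] Aᵐᵒᵖ :=
  Fin.cons
    (S.envMk ![S.envCoord 1 (x 0) -
      ((-1 : K) ^ (n + 1) * ρ ^ n) • leftMul (K := K) S.v (S.envCoord 3 (x 0)), 0, 0, 0])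
    fun b => S.envMk ![S.envCoord 2 (x b), S.envCoord 3 (x b), 0, 0]

/-- Coordinates 3 and 2 (along uv and v) are recovered for every `x`, cycle or not: the homotopy
strips a left factor v, the left part of `dV` restores it, and no other term contributes there. -/
theorem envCoord_freeD_homotopy_three (n : ℕ) (x : Fin (n + 1) → A ⊗[K] Aᵐᵒᵖ) (b : Fin (n + 1)) :
    S.envCoord 3 (S.freeD n (S.homotopy n x) b) = S.envCoord 3 (x b) := by
  rw [freeD_apply, map_add, envCoord_mul_dU, envCoord_mul_dV]
  cases b using Fin.cases <;>
  simp [homotopy, envCoord_envMk, ← Fin.succ_castSucc]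

theorem envCoord_freeD_homotopy_two (n : ℕ) (x : Fin (n + 1) → A ⊗[K] Aᵐᵒᵖ) (b : Fin (n + 1)) :
    S.envCoord 2 (S.freeD n (S.homotopy n x) b) = S.envCoord 2 (x b) := by
  rw [freeD_apply, map_add, envCoord_mul_dU, envCoord_mul_dV]
  cases b using Fin.cases <;>
  simp [homotopy, envCoord_envMk, ← Fin.succ_castSucc]

/-- The term subtracted in the zeroth entry of `homotopy` is chosen for this coordinate: it cancels
what the right multiplication by v in `dV` contributes. -/
theorem envCoord_freeD_homotopy_one_zero (n : ℕ) (x : Fin (n + 1) → A ⊗[K] Aᵐᵒᵖ) :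
    S.envCoord 1 (S.freeD n (S.homotopy n x) 0) = S.envCoord 1 (x 0) := by
  rw [freeD_apply, map_add, envCoord_mul_dU, envCoord_mul_dV]
  simp [homotopy, envCoord_envMk]

theorem leftMul_vu (x : ZMod 4 → A) : leftMul (K := K) S.v (leftMul (K := K) S.u x) =
    -(ρ • leftMul (K := K) S.u (leftMul (K := K) S.v x)) := by
  rw [leftMul_leftMul, leftMul_leftMul, S.v_mul_u]
  ext i; simp [leftMul, -Pi.mul_apply, mul_assoc]

theorem leftMul_vv (x : ZMod 4 → A) : leftMul (K := K) S.v (leftMul (K := K) S.v x) = 0 := by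
  rw [leftMul_leftMul, S.v_mul_v]
  ext i; simp [leftMul]

/-- The cycle condition enters only in coordinate 0 and, away from component 0, in coordinate 1;
there the coordinates of the equation `hx` express the missing terms. -/
theorem freeD_homotopy (n : ℕ) (x : Fin (n + 2) → A ⊗[K] Aᵐᵒᵖ) (hx : S.freeD n x = 0) :
    S.freeD (n + 1) (S.homotopy (n + 1) x) = x := by
  have key (m : Fin 4) (b : Fin (n + 1)) : S.envCoord m (S.freeD n x b) = 0 := by simp [hx]
  simp only [freeD_apply, map_add, envCoord_mul_dU, envCoord_mul_dV] at key
  funext b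
  refine S.env_ext fun m => ?_
  have h1 (b : Fin (n + 1)) := key 1 b
  have h2 (b : Fin (n + 1)) := key 2 b
  have h3 (b : Fin (n + 1)) := key 3 b
  simp at h1 h2 h3
  fin_cases m
  · change S.envCoord 0 _ = S.envCoord 0 _
    rw [freeD_apply, map_add, envCoord_mul_dU, envCoord_mul_dV]
    cases b using Fin.cases with
    | zero =>
      have h1 := h1 0
      -- Multiplied by v, coordinate 3 of the cycle equation loses its vv term; it then eliminates
      -- from coordinate 1 the term that involves component 1 of `x`.
      have h3 := congrArg (leftMul (K := K) S.v) (h3 0)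
      simp [leftMul_vu, leftMul_vv] at h1 h3
      simp [homotopy, envCoord_envMk]
      obtain hε | hε := neg_one_pow_eq_or K (n + 1) <;> rw [pow_succ, hε] <;> rw [hε] at h1 h3
      · linear_combination (norm := module) (-1 : K) • h1 + ρ ^ n • h3
      · linear_combination (norm := module) (-1 : K) • h1 - ρ ^ n • h3
    | succ b =>
      have h2 := h2 b
      simp [homotopy, envCoord_envMk, ← Fin.succ_castSucc]
      linear_combination (norm := module) (-1:K) • h2
  · change S.envCoord 1 _ = S.envCoord 1 _
    cases b using Fin.cases with
    | zero => exact S.envCoord_freeD_homotopy_one_zero _ _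
    | succ b =>
      rw [freeD_apply, map_add, envCoord_mul_dU, envCoord_mul_dV]
      have h3 := h3 b
      simp [homotopy, envCoord_envMk, ← Fin.succ_castSucc]
      linear_combination (norm := module) (-1:K) • h3
  · exact S.envCoord_freeD_homotopy_two _ _ _
  · exact S.envCoord_freeD_homotopy_three _ _ _

end

end QuantumCover

/-! ### Extension groups from projective resolutions -/

section ExtGroups

open CategoryTheory CategoryTheory.Abelian

universe w v

/-- An exact sequence of projective modules ending in `Z`, as a projective resolution of `Z`. -/
noncomputable def ModuleCat.projectiveResolutionOfExact {R : Type u} [Ring R] (Z : ModuleCat.{u} R)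
    (X : ℕ → ModuleCat.{u} R) (d : ∀ n, X (n + 1) ⟶ X n) (ε : X 0 ⟶ Z)
    (hX : ∀ n, Projective (X n)) (hd : ∀ n, d (n + 1) ≫ d n = 0) (hε : d 0 ≫ ε = 0)
    (exact_succ : ∀ n (x : X (n + 1)), d n x = 0 → ∃ y, d (n + 1) y = x)
    (exact_zero : ∀ x : X 0, ε x = 0 → ∃ y, d 0 y = x)
    (surjective : Function.Surjective ε) : ProjectiveResolution Z where
  complex := ChainComplex.of X d hd
  projective := hX
  π := (ChainComplex.toSingle₀Equiv _ _).symm ⟨ε, by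
    have h : (ChainComplex.of X d hd).d 1 0 = d 0 := ChainComplex.of_d X d 0
    rw [h]
    exact hε⟩
  quasiIso := ⟨fun n => by
    cases n with
    | zero =>
      rw [ChainComplex.quasiIsoAt₀_iff, ShortComplex.quasiIso_iff_of_zeros' _ rfl rfl rfl]
      refine (ShortComplex.exact_and_epi_g_iff_of_iso (S₂ := ShortComplex.mk (d 0) ε hε) ?_).2
        ⟨(ShortComplex.moduleCat_exact_iff _).2 exact_zero,
          (ModuleCat.epi_iff_surjective _).2 surjective⟩
      exact ShortComplex.isoMk (Iso.refl _) (Iso.refl _) (Iso.refl _)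
        (by
          have h : (ChainComplex.of X d hd).d 1 0 = d 0 := ChainComplex.of_d X d 0
          change 𝟙 _ ≫ d 0 = (ChainComplex.of X d hd).d 1 0 ≫ 𝟙 _
          rw [h, Category.id_comp, Category.comp_id])
        (by
          change 𝟙 _ ≫ ε =
            ((ChainComplex.toSingle₀Equiv (ChainComplex.of X d hd) Z).symm ⟨ε, _⟩).f 0 ≫ 𝟙 _
          rw [ChainComplex.toSingle₀Equiv_symm_apply_f_zero]
          exact (Category.id_comp ε).trans (Category.comp_id ε).symm)
    | succ n =>
      rw [quasiIsoAt_iff_exactAt' (hL := ChainComplex.exactAt_succ_single_obj ..),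
        HomologicalComplex.exactAt_iff' _ (n + 1 + 1) (n + 1) n (by simp) (by simp),
        ShortComplex.moduleCat_exact_iff]
      have h₁ : (ChainComplex.of X d hd).d (n + 1) n = d n := ChainComplex.of_d X d n
      have h₂ : (ChainComplex.of X d hd).d (n + 1 + 1) (n + 1) = d (n + 1) :=
        ChainComplex.of_d X d (n + 1)
      change ∀ x : X (n + 1), (ChainComplex.of X d hd).d (n + 1) n x = 0 →
        ∃ y, (ChainComplex.of X d hd).d (n + 1 + 1) (n + 1) y = x
      rw [h₁, h₂]
      exact exact_succ n⟩

variable {K : Type u} [Field K] {C : Type w} [Category.{v} C] [Abelian C] [Linear K C] {X Y : C} (P : ProjectiveResolution X)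

variable (K Y) in
/-- The cocycles of degree `n` in the complex of morphisms to `Y`. -/
def CategoryTheory.ProjectiveResolution.cocycles (n : ℕ) :
    Submodule K (P.complex.X n ⟶ Y) where
  carrier := {f | P.complex.d (n + 1) n ≫ f = 0}
  add_mem' {f g} hf hg := by
    rw [Set.mem_ofPred_eq] at *
    rw [Preadditive.comp_add, hf, hg, add_zero]
  zero_mem' := Limits.comp_zero
  smul_mem' c f hf := by
    rw [Set.mem_ofPred_eq] at *
    rw [Linear.comp_smul, hf, smul_zero]

theorem CategoryTheory.ProjectiveResolution.mem_cocycles {n : ℕ} {f : P.complex.X n ⟶ Y} :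
    f ∈ P.cocycles K Y n ↔ P.complex.d (n + 1) n ≫ f = 0 := Iff.rfl

variable [HasExt.{u} C]

theorem CategoryTheory.ProjectiveResolution.smul_extMk {n : ℕ} (c : K) (f : P.complex.X n ⟶ Y)
    (hf : P.complex.d (n + 1) n ≫ f = 0) (hcf : P.complex.d (n + 1) n ≫ (c • f) = 0) :
    P.extMk (c • f) (n + 1) rfl hcf = c • P.extMk f (n + 1) rfl hf := by
  rw [Ext.smul_eq_comp_mk₀, P.extMk_comp_mk₀]
  congr 1
  rw [Linear.comp_smul, Category.comp_id]

variable (K Y) in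
/-- The class of a cocycle, as a linear map. -/
noncomputable def CategoryTheory.ProjectiveResolution.extClassLinear (n : ℕ) :
    P.cocycles K Y n →ₗ[K] Ext.{u} X Y n where
  toFun f := P.extMk f.1 (n + 1) rfl (P.mem_cocycles.1 f.2)
  map_add' f g :=
    (P.add_extMk f.1 g.1 (n + 1) rfl (P.mem_cocycles.1 f.2) (P.mem_cocycles.1 g.2)).symm
  map_smul' c f := P.smul_extMk c f.1 _ _

/-- `Extⁿ⁺¹` is identified with the target of any linear map on cochains that maps the cocycles
onto it and, among the cocycles, vanishes exactly on the coboundaries. -/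
theorem CategoryTheory.ProjectiveResolution.nonempty_ext_linearEquiv {n : ℕ} {V : Type*}
    [AddCommGroup V] [Module K V] (F : (P.complex.X (n + 1) ⟶ Y) →ₗ[K] V)
    (surj : ∀ w, ∃ f, P.complex.d (n + 2) (n + 1) ≫ f = 0 ∧ F f = w)
    (ker : ∀ f, P.complex.d (n + 2) (n + 1) ≫ f = 0 →
      (F f = 0 ↔ ∃ g, P.complex.d (n + 1) n ≫ g = f)) :
    Nonempty (Ext.{u} X Y (n + 1) ≃ₗ[K] V) := by
  let G := F.comp (P.cocycles K Y (n + 1)).subtype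
  have hG : Function.Surjective G := fun w =>
    let ⟨f, hf, hw⟩ := surj w
    ⟨⟨f, hf⟩, hw⟩
  have hE : Function.Surjective (P.extClassLinear K Y (n + 1)) := fun α =>
    let ⟨f, hf, h⟩ := P.extMk_surjective α (n + 2) rfl
    ⟨⟨f, hf⟩, h⟩
  -- Both maps are surjective on the cocycles and have the coboundaries as kernel, so their targets
  -- are isomorphic.
  have h : LinearMap.ker (P.extClassLinear K Y (n + 1)) = LinearMap.ker G := by
    ext ⟨f, hf⟩
    rw [LinearMap.mem_ker, LinearMap.mem_ker]
    exact (P.extMk_eq_zero_iff f (n + 2) rfl hf n rfl).trans (ker f hf).symm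
  exact ⟨((P.extClassLinear K Y (n + 1)).quotKerEquivOfSurjective hE).symm.trans
    ((Submodule.quotEquivOfEq _ _ h).trans (G.quotKerEquivOfSurjective hG))⟩

end ExtGroups

namespace QuantumCover

noncomputable section

open MulOpposite

attribute [local instance] instModuleTensorProductMop

/-! ### The action of the enveloping algebra on the regular bimodule -/

section Action

variable {K A : Type*} [Field K] [Ring A] [Algebra K A]

theorem tmul_smul (a : A) (w : Aᵐᵒᵖ) (z : A) : (a ⊗ₜ[K] w) • z = a * z * unop w := by
  rw [TensorProduct.Algebra.smul_def, smul_eq_mul, mul_assoc]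
  rfl

theorem env_zero_smul (z : A) : (0 : A ⊗[K] Aᵐᵒᵖ) • z = 0 := zero_smul (A ⊗[K] Aᵐᵒᵖ) z

theorem scalar_smul_smul (c : K) (r : A ⊗[K] Aᵐᵒᵖ) (z : A) : (c • r) • z = c • (r • z) := by
  induction r with
  | zero => rw [smul_zero, env_zero_smul, smul_zero]
  | add x y hx hy => rw [smul_add, add_smul, add_smul, smul_add, hx, hy]
  | tmul a w => rw [TensorProduct.smul_tmul', tmul_smul, tmul_smul, smul_mul_assoc, smul_mul_assoc]

theorem lft_smul (a z : A) : lft K a • z = a * z := by simp [lft, tmul_smul]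

theorem rgt_smul (a z : A) : rgt K a • z = z * a := by simp [rgt, tmul_smul]

end Action

/-! ### Truncation of the free complex to the Koszul resolution -/

section Truncation

variable {K A : Type*} [Field K] [Ring A] [Algebra K A] {ρ : K} (S : QuantumCover K A ρ)

/-- The idempotent of the enveloping algebra that selects the elements of degree `n`. -/
def trunc (n : ℕ) : A ⊗[K] Aᵐᵒᵖ := ∑ i, S.e i ⊗ₜ op (S.e (i + n))

theorem trunc_mul_trunc (n : ℕ) : S.trunc n * S.trunc n = S.trunc n := by
  rw [trunc, Finset.sum_mul]
  refine Finset.sum_congr rfl fun i _ => ?_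
  rw [Finset.mul_sum, Finset.sum_eq_single i]
  · simp [Algebra.TensorProduct.tmul_mul_tmul, ← op_mul, S.e_mul_e]
  · intro j _ hj
    simp [Algebra.TensorProduct.tmul_mul_tmul, S.e_mul_e, hj.symm]
  · simp

/-- Moving `a` across e_i advances the left vertex by one, and the sum is reindexed by i ↦ i + 1. On
the right factor, treated next, the vertex i + n + 1 drops to i + n and no reindexing occurs. -/
theorem trunc_succ_mul_lft (n : ℕ) {a : A} (h : ∀ i, S.e i * a = a * S.e (i + 1)) :
    S.trunc (n + 1) * lft K a = lft K a * S.trunc n := by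
  rw [trunc, trunc, Finset.sum_mul, Finset.mul_sum, ← Equiv.sum_comp (Equiv.addRight (1 : ZMod 4))
    (fun i => lft K a * S.e i ⊗ₜ op (S.e (i + n)))]
  refine Finset.sum_congr rfl fun i _ => ?_
  simp only [lft, Algebra.TensorProduct.tmul_mul_tmul, h, one_mul, mul_one, Equiv.coe_addRight]
  rw [Nat.cast_succ, add_right_comm i, add_assoc i]

theorem trunc_succ_mul_rgt (n : ℕ) {a : A} (h : ∀ i, S.e i * a = a * S.e (i + 1)) :
    S.trunc (n + 1) * rgt K a = rgt K a * S.trunc n := by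
  rw [trunc, trunc, Finset.sum_mul, Finset.mul_sum]
  refine Finset.sum_congr rfl fun i _ => ?_
  simp only [rgt, Algebra.TensorProduct.tmul_mul_tmul, one_mul, mul_one, ← op_mul, h]
  rw [Nat.cast_succ, add_assoc i]

theorem trunc_succ_mul_dU (n b : ℕ) : S.trunc (n + 1) * S.dU n b = S.dU n b * S.trunc n := by
  simp only [dU, mul_add, add_mul, mul_smul_comm, smul_mul_assoc,
    S.trunc_succ_mul_lft n S.e_mul_u, S.trunc_succ_mul_rgt n S.e_mul_u]

theorem trunc_succ_mul_dV (n b : ℕ) : S.trunc (n + 1) * S.dV n b = S.dV n b * S.trunc n := by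
  simp only [dV, mul_add, add_mul, mul_smul_comm, smul_mul_assoc,
    S.trunc_succ_mul_lft n S.e_mul_v, S.trunc_succ_mul_rgt n S.e_mul_v]

/-- Truncation of a family of elements of the enveloping algebra. -/
def truncMap (n : ℕ) :
    (Fin (n + 1) → A ⊗[K] Aᵐᵒᵖ) →ₗ[A ⊗[K] Aᵐᵒᵖ] (Fin (n + 1) → A ⊗[K] Aᵐᵒᵖ) where
  toFun x b := x b * S.trunc n
  map_add' x y := by ext b; simp [add_mul]
  map_smul' r x := by ext b; simp [mul_assoc]

theorem freeD_truncMap (n : ℕ) (x : Fin (n + 2) → A ⊗[K] Aᵐᵒᵖ) :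
    S.freeD n (S.truncMap (n + 1) x) = S.truncMap n (S.freeD n x) := by
  ext b
  simp only [freeD_apply, truncMap, LinearMap.coe_mk, AddHom.coe_mk, add_mul, mul_assoc,
    trunc_succ_mul_dU, trunc_succ_mul_dV]

/-- The modules of the Koszul bimodule resolution. -/
def koszul (n : ℕ) : Submodule (A ⊗[K] Aᵐᵒᵖ) (Fin (n + 1) → A ⊗[K] Aᵐᵒᵖ) :=
  LinearMap.eqLocus (S.truncMap n) LinearMap.id

theorem mem_koszul {n : ℕ} {x : Fin (n + 1) → A ⊗[K] Aᵐᵒᵖ} :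
    x ∈ S.koszul n ↔ S.truncMap n x = x := Iff.rfl

theorem truncMap_mem (n : ℕ) (x : Fin (n + 1) → A ⊗[K] Aᵐᵒᵖ) : S.truncMap n x ∈ S.koszul n := by
  rw [mem_koszul]
  ext b
  simp [truncMap, mul_assoc, trunc_mul_trunc]

/-- Right multiplication by the idempotent `trunc n` retracts a finite free module onto this
submodule. -/
instance (n : ℕ) : Module.Projective (A ⊗[K] Aᵐᵒᵖ) (S.koszul n) :=
  Module.Projective.of_split (S.koszul n).subtype
    ((S.truncMap n).codRestrict (S.koszul n) (S.truncMap_mem n))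
    (by ext1 x; exact Subtype.ext x.2)

/-- The differential of the Koszul bimodule resolution. -/
def koszulD (n : ℕ) : S.koszul (n + 1) →ₗ[A ⊗[K] Aᵐᵒᵖ] S.koszul n :=
  (S.freeD n).restrict fun x hx => by
    rw [mem_koszul] at hx ⊢
    rw [← freeD_truncMap, hx]

theorem coe_koszulD (n : ℕ) (x : S.koszul (n + 1)) :
    (S.koszulD n x : Fin (n + 1) → A ⊗[K] Aᵐᵒᵖ) = S.freeD n x := rfl

theorem koszulD_koszulD (n : ℕ) (x : S.koszul (n + 2)) : S.koszulD n (S.koszulD (n + 1) x) = 0 :=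
  Subtype.ext (S.freeD_freeD n x)

/-- The value of the homotopy is truncated to bring it into the submodule; this is harmless, since
truncation commutes with the differential and fixes `x`. -/
theorem koszulD_exact (n : ℕ) (x : S.koszul (n + 1)) (hx : S.koszulD n x = 0) :
    ∃ y, S.koszulD (n + 1) y = x := by
  refine ⟨⟨_, S.truncMap_mem _ (S.homotopy (n + 1) x)⟩, Subtype.ext ?_⟩
  rw [coe_koszulD, freeD_truncMap, freeD_homotopy S n x (congrArg Subtype.val hx)]
  exact x.2

/-- The augmentation of the Koszul bimodule resolution. -/
def augmentation : S.koszul 0 →ₗ[A ⊗[K] Aᵐᵒᵖ] A :=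
  (LinearMap.toSpanSingleton (A ⊗[K] Aᵐᵒᵖ) A 1).comp
    ((LinearMap.proj 0).comp (S.koszul 0).subtype)

theorem augmentation_apply (x : S.koszul 0) : S.augmentation x = x.1 0 • (1 : A) := rfl

theorem trunc_zero_smul_one : S.trunc 0 • (1 : A) = 1 := by
  simp [trunc, Finset.sum_smul, tmul_smul, S.e_mul_e, S.sum_e]

theorem augmentation_surjective : Function.Surjective S.augmentation := fun a => by
  refine ⟨⟨_, S.truncMap_mem 0 fun _ => lft K a⟩, ?_⟩
  simp [augmentation_apply, truncMap, mul_smul, trunc_zero_smul_one, lft_smul]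

theorem augmentation_koszulD (x : S.koszul 1) : S.augmentation (S.koszulD 0 x) = 0 := by
  rw [augmentation_apply, coe_koszulD, freeD_apply, add_smul, mul_smul, mul_smul]
  have h₁ : S.dU 0 (0 : Fin 1) • (1 : A) = 0 := by
    simp [dU, add_smul, lft_smul, rgt_smul, scalar_smul_smul]
  have h₂ : S.dV 0 (0 : Fin 1) • (1 : A) = 0 := by
    simp [dV, add_smul, lft_smul, rgt_smul, scalar_smul_smul]
  rw [h₁, h₂, smul_zero, smul_zero, add_zero]

theorem tmul_mul_trunc_zero {a : A} {k : ZMod 4} (h : a * S.e k = a) (w : Aᵐᵒᵖ) :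
    (a ⊗ₜ[K] w) * S.trunc 0 = a ⊗ₜ[K] op (S.e k * unop w) := by
  rw [trunc, Finset.mul_sum, Finset.sum_eq_single k]
  · simp [Algebra.TensorProduct.tmul_mul_tmul, h]
  · intro j _ hj
    rw [Algebra.TensorProduct.tmul_mul_tmul, ← h, mul_assoc, S.e_mul_e, if_neg hj.symm, mul_zero,
      TensorProduct.zero_tmul]
  · simp

/-- The sum of the products of the coordinates with the monomials. -/
def evalCoord : A ⊗[K] Aᵐᵒᵖ →ₗ[K] (ZMod 4 → A) :=
  S.envCoord 0 + (leftMul S.u).comp (S.envCoord 1) + (leftMul S.v).comp (S.envCoord 2) +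
    (leftMul (S.u * S.v)).comp (S.envCoord 3)

/-- Truncation in degree 0 inserts the end vertex of the left monomial before the right factor, and
multiplying the factors together absorbs it. An element of the augmentation kernel thus satisfies
`evalCoord = 0`, the equation needed for exactness in degree 0. -/
theorem evalCoord_mul_trunc_zero (x : A ⊗[K] Aᵐᵒᵖ) (i : ZMod 4) :
    S.evalCoord (x * S.trunc 0) i = S.e i * (x • (1 : A)) := by
  induction x with
  | zero => rw [zero_mul, map_zero, env_zero_smul, mul_zero, Pi.zero_apply]
  | add x y hx hy => simp [add_mul, add_smul, mul_add, hx, hy]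
  | tmul a w =>
    let f : A →ₗ[K] A := ((LinearMap.proj i).comp S.evalCoord).comp
      ((LinearMap.mulRight K (S.trunc 0)).comp ((TensorProduct.mk K A Aᵐᵒᵖ).flip w))
    let g : A →ₗ[K] A := (LinearMap.mulLeft K (S.e i)).comp (LinearMap.mulRight K (unop w))
    have key (a : A) : f a = S.evalCoord ((a ⊗ₜ w) * S.trunc 0) i := rfl
    -- One computation serves all four monomials t, where e_j t ends at the vertex k.
    have aux (j k : ZMod 4) (t : A) (ht : S.e j * t = t * S.e k)
        (hev : ∀ z, S.evalCoord ((S.e j * t) ⊗ₜ z) = Pi.single j (t * unop z)) :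
        f (S.e j * t) = g (S.e j * t) := by
      rw [key, S.tmul_mul_trunc_zero (k := k) (by rw [ht, mul_assoc, S.e_mul_e, if_pos rfl]), hev,
        unop_op, ← mul_assoc, ← ht]
      by_cases hij : i = j
      · subst hij
        simp [g, ← mul_assoc, S.e_mul_e]
      · simp [g, ← mul_assoc, S.e_mul_e, hij]
    have h : f = g := by
      refine S.coord_ext (fun j => ?_) (fun j => ?_) (fun j => ?_) (fun j => ?_)
      · rw [← mul_one (S.e j)]
        refine aux j j 1 (by simp) fun z => ?_
        ext l
        simp [evalCoord, envCoord_tmul, coord_e, leftMul, Pi.single_apply]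
      · refine aux j (j + 1) S.u (S.e_mul_u j) fun z => ?_
        ext l
        simp [evalCoord, envCoord_tmul, coord_e_mul_u, leftMul, Pi.single_apply]
      · refine aux j (j + 1) S.v (S.e_mul_v j) fun z => ?_
        ext l
        simp [evalCoord, envCoord_tmul, coord_e_mul_v, leftMul, Pi.single_apply]
      · refine aux j (j + 1 + 1) (S.u * S.v)
          (by rw [← mul_assoc, S.e_mul_u, mul_assoc, S.e_mul_v, mul_assoc]) fun z => ?_
        ext l
        simp [evalCoord, envCoord_tmul, coord_e_mul_uv, leftMul, Pi.single_apply, mul_assoc]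
    rw [← key, h, tmul_smul]
    simp [g]

/-- The homotopy is the one used in positive degrees; coordinate 0 now comes from the augmentation
instead of a cycle equation. -/
theorem koszulD_exact_zero (x : S.koszul 0) (hx : S.augmentation x = 0) :
    ∃ y, S.koszulD 0 y = x := by
  refine ⟨⟨_, S.truncMap_mem _ (S.homotopy 0 x)⟩, Subtype.ext ?_⟩
  have hx' : x.1 0 * S.trunc 0 = x.1 0 := congrFun x.2 0
  rw [coe_koszulD, freeD_truncMap]
  suffices h : S.freeD 0 (S.homotopy 0 x) = x by rw [h]; exact x.2
  have hev : S.evalCoord (x.1 0) = 0 := by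
    ext i
    rw [← hx', evalCoord_mul_trunc_zero, ← augmentation_apply, hx, mul_zero, Pi.zero_apply]
  funext b
  obtain rfl : b = 0 := Fin.eq_zero b
  refine S.env_ext fun m => ?_
  fin_cases m
  · change S.envCoord 0 _ = S.envCoord 0 _
    rw [freeD_apply, map_add, envCoord_mul_dU, envCoord_mul_dV]
    simp [evalCoord] at hev
    simp [homotopy, envCoord_envMk, leftMul_leftMul]
    linear_combination (norm := module) (-1 : K) • hev
  · exact S.envCoord_freeD_homotopy_one_zero _ _
  · exact S.envCoord_freeD_homotopy_two _ _ _
  · exact S.envCoord_freeD_homotopy_three _ _ _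

end Truncation

end

end QuantumCover

namespace QuantumCover

noncomputable section

open MulOpposite CategoryTheory CategoryTheory.Abelian

attribute [local instance] instModuleTensorProductMop

/-! #### The complex computing Hochschild cohomology -/

section Cochains

variable {K A : Type*} [Field K] [Ring A] [Algebra K A] {ρ : K} (S : QuantumCover K A ρ)

/-- The homogeneous elements of degree `n`. -/
def IsHomog (n : ℕ) (z : A) : Prop := ∑ i, S.e i * z * S.e (i + n) = z

theorem trunc_smul (n : ℕ) (z : A) : S.trunc n • z = ∑ i, S.e i * z * S.e (i + n) := by
  rw [trunc, Finset.sum_smul]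
  simp [tmul_smul]

theorem isHomog_iff {n : ℕ} {z : A} : S.IsHomog n z ↔ S.trunc n • z = z := by
  rw [trunc_smul, IsHomog]

/-- The part of the codifferential that raises the exponent of `u`. -/
def coU (n b : ℕ) (z : A) : A := ρ ^ b • (S.u * z) + (-1 : K) ^ (n + 1) • (z * S.u)

/-- The part of the codifferential that raises the exponent of `v`. -/
def coV (n b : ℕ) (z : A) : A := S.v * z + ((-1 : K) ^ (n + 1) * ρ ^ (n - b)) • (z * S.v)

theorem dU_smul (n b : ℕ) (z : A) : S.dU n b • z = S.coU n b z := by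
  rw [dU, add_smul, scalar_smul_smul, scalar_smul_smul, lft_smul, rgt_smul, coU]

theorem dV_smul (n b : ℕ) (z : A) : S.dV n b • z = S.coV n b z := by
  rw [dV, add_smul, scalar_smul_smul, lft_smul, rgt_smul, coV]

/-- The codifferential. -/
def coD (n : ℕ) (m : Fin (n + 1) → A) : Fin (n + 2) → A :=
  (Fin.snoc (fun b => S.coU n b (m b)) 0 : Fin (n + 2) → A) +
    (Fin.cons 0 (fun b => S.coV n b (m b)) : Fin (n + 2) → A)

theorem coD_zero (n : ℕ) (m : Fin (n + 1) → A) : S.coD n m 0 = S.coU n 0 (m 0) := by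
  rw [coD, Pi.add_apply, Fin.cons_zero, add_zero]
  exact Fin.snoc_castSucc (α := fun _ => A) 0 _ (0 : Fin (n + 1))

theorem coD_last (n : ℕ) (m : Fin (n + 1) → A) :
    S.coD n m (Fin.last (n + 1)) = S.coV n n (m (Fin.last n)) := by
  rw [coD, Pi.add_apply, Fin.snoc_last, zero_add, ← Fin.succ_last, Fin.cons_succ, Fin.val_last]

theorem coD_succ_castSucc (n : ℕ) (m : Fin (n + 2) → A) (b : Fin (n + 1)) :
    S.coD (n + 1) m b.succ.castSucc =
      S.coU (n + 1) (b + 1) (m b.succ) + S.coV (n + 1) b (m b.castSucc) := by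
  rw [coD, Pi.add_apply, Fin.snoc_castSucc, ← Fin.succ_castSucc, Fin.cons_succ]
  simp

theorem isHomog_coU {n b : ℕ} {z : A} (hz : S.IsHomog n z) : S.IsHomog (n + 1) (S.coU n b z) := by
  rw [isHomog_iff] at *
  rw [← dU_smul, ← mul_smul, trunc_succ_mul_dU, mul_smul, hz]

theorem isHomog_coV {n b : ℕ} {z : A} (hz : S.IsHomog n z) : S.IsHomog (n + 1) (S.coV n b z) := by
  rw [isHomog_iff] at *
  rw [← dV_smul, ← mul_smul, trunc_succ_mul_dV, mul_smul, hz]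

theorem IsHomog.zero (n : ℕ) : S.IsHomog n 0 := by simp [IsHomog]

variable {S} in
theorem IsHomog.add {n : ℕ} {z w : A} (hz : S.IsHomog n z) (hw : S.IsHomog n w) :
    S.IsHomog n (z + w) := by
  rw [isHomog_iff] at *
  rw [smul_add, hz, hw]

theorem isHomog_coD {n : ℕ} {m : Fin (n + 1) → A} (hm : ∀ b, S.IsHomog n (m b)) (c : Fin (n + 2)) :
    S.IsHomog (n + 1) (S.coD n m c) := by
  rw [coD]
  refine IsHomog.add ?_ ?_
  · cases c using Fin.lastCases with
    | last => simpa using IsHomog.zero S _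
    | cast b => simpa using S.isHomog_coU (hm b)
  · cases c using Fin.cases with
    | zero => simpa using IsHomog.zero S _
    | succ b => simpa using S.isHomog_coV (hm b)

/-- The morphism from the Koszul resolution given by a cochain. -/
def ofCochain (n : ℕ) (m : Fin (n + 1) → A) : S.koszul n →ₗ[A ⊗[K] Aᵐᵒᵖ] A where
  toFun x := ∑ b, x.1 b • m b
  map_add' x y := by simp [add_smul, Finset.sum_add_distrib]
  map_smul' r x := by simp [mul_smul, Finset.smul_sum]

theorem ofCochain_apply (n : ℕ) (m : Fin (n + 1) → A) (x : S.koszul n) :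
    S.ofCochain n m x = ∑ b, x.1 b • m b := rfl

theorem ofCochain_koszulD (n : ℕ) (m : Fin (n + 1) → A) (x : S.koszul (n + 1)) :
    S.ofCochain n m (S.koszulD n x) = S.ofCochain (n + 1) (S.coD n m) x := by
  simp only [ofCochain_apply, coe_koszulD, freeD_apply, coD, Pi.add_apply, smul_add,
    Finset.sum_add_distrib, add_smul, mul_smul, dU_smul, dV_smul]
  congr 1
  · rw [Fin.sum_univ_castSucc (n := n + 1)]
    simp
  · rw [Fin.sum_univ_succ (n := n + 1)]
    simp

/-- The generators of the modules in the Koszul resolution. -/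
def gen (n : ℕ) (b : Fin (n + 1)) : S.koszul n :=
  ⟨_, S.truncMap_mem n (Pi.single b 1)⟩

theorem coe_gen (n : ℕ) (b c : Fin (n + 1)) : (S.gen n b).1 c = if c = b then S.trunc n else 0 := by
  by_cases h : c = b
  · subst h; simp [gen, truncMap]
  · simp [gen, truncMap, h]

theorem eq_sum_gen (n : ℕ) (x : S.koszul n) : x = ∑ b, x.1 b • S.gen n b := by
  refine Subtype.ext (funext fun c => ?_)
  have hx : x.1 c * S.trunc n = x.1 c := congrFun x.2 c
  rw [AddSubmonoidClass.coe_finsetSum, Finset.sum_apply, Finset.sum_eq_single c]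
  · simp [coe_gen, hx]
  · intro b _ hb
    simp [coe_gen, hb.symm]
  · simp

/-- The cochain given by a morphism from the Koszul resolution. -/
def toCochain (n : ℕ) (f : S.koszul n →ₗ[A ⊗[K] Aᵐᵒᵖ] A) (b : Fin (n + 1)) : A := f (S.gen n b)

theorem ofCochain_toCochain (n : ℕ) (f : S.koszul n →ₗ[A ⊗[K] Aᵐᵒᵖ] A) :
    S.ofCochain n (S.toCochain n f) = f := by
  ext x
  conv_rhs => rw [S.eq_sum_gen n x, map_sum]
  simp [ofCochain_apply, toCochain]

/-- The generators are fixed by `trunc n`, and a bimodule map preserves this. -/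
theorem isHomog_toCochain (n : ℕ) (f : S.koszul n →ₗ[A ⊗[K] Aᵐᵒᵖ] A) (b : Fin (n + 1)) :
    S.IsHomog n (S.toCochain n f b) := by
  rw [isHomog_iff, toCochain, ← map_smul]
  congr 1
  refine Subtype.ext (funext fun c => ?_)
  rw [Submodule.coe_smul, Pi.smul_apply, coe_gen, smul_eq_mul]
  split_ifs
  · rw [trunc_mul_trunc]
  · rw [mul_zero]

theorem toCochain_ofCochain {n : ℕ} {m : Fin (n + 1) → A} (hm : ∀ b, S.IsHomog n (m b)) :
    S.toCochain n (S.ofCochain n m) = m := by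
  ext b
  rw [toCochain, ofCochain_apply, Finset.sum_eq_single b]
  · rw [coe_gen, if_pos rfl, ← isHomog_iff]
    exact hm b
  · intro c _ hc
    rw [coe_gen, if_neg hc, env_zero_smul]
  · simp

theorem toCochain_comp_koszulD (n : ℕ) (f : S.koszul n →ₗ[A ⊗[K] Aᵐᵒᵖ] A) :
    S.toCochain (n + 1) (f.comp (S.koszulD n)) = S.coD n (S.toCochain n f) := by
  rw [← S.toCochain_ofCochain (S.isHomog_coD (S.isHomog_toCochain n f))]
  congr 1
  ext x
  rw [← ofCochain_koszulD, ofCochain_toCochain, LinearMap.comp_apply]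

theorem toCochain_injective (n : ℕ) : Function.Injective (S.toCochain n) :=
  Function.LeftInverse.injective (S.ofCochain_toCochain n)

end Cochains

/-! ### Hochschild cohomology from Koszul cochains -/

section Hochschild

variable {K A : Type u} [Field K] [Ring A] [Algebra K A] {ρ : K} (S : QuantumCover K A ρ)

/-- The Koszul bimodule resolution. -/
def resolution : ProjectiveResolution (ModuleCat.of (A ⊗[K] Aᵐᵒᵖ) A) :=
  ModuleCat.projectiveResolutionOfExact (ModuleCat.of (A ⊗[K] Aᵐᵒᵖ) A)
    (fun n => ModuleCat.of (A ⊗[K] Aᵐᵒᵖ) (S.koszul n)) (fun n => ModuleCat.ofHom (S.koszulD n))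
    (ModuleCat.ofHom S.augmentation)
    (fun n => (IsProjective.iff_projective _).1 inferInstance)
    (fun n => by ext x : 2; exact S.koszulD_koszulD n x)
    (by ext x : 2; exact S.augmentation_koszulD x)
    S.koszulD_exact S.koszulD_exact_zero S.augmentation_surjective

theorem resolution_d (n : ℕ) : S.resolution.complex.d (n + 1) n = ModuleCat.ofHom (S.koszulD n) :=
  ChainComplex.of_d (fun n => ModuleCat.of (A ⊗[K] Aᵐᵒᵖ) (S.koszul n))
    (fun n => ModuleCat.ofHom (S.koszulD n)) n

/-- The cochain of a morphism, as a linear map. -/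
def cochainLinear (n : ℕ) :
    (S.resolution.complex.X n ⟶ ModuleCat.of (A ⊗[K] Aᵐᵒᵖ) A) →ₗ[K] (Fin (n + 1) → A) where
  toFun f := S.toCochain n f.hom
  map_add' f g := rfl
  map_smul' c f := by
    ext b
    -- Scalars act on morphisms through the enveloping algebra.
    change (algebraMap K (A ⊗[K] Aᵐᵒᵖ) c) • (S.toCochain n f.hom b) = c • S.toCochain n f.hom b
    rw [Algebra.algebraMap_eq_smul_one, scalar_smul_smul, one_smul]

theorem cochainLinear_injective (n : ℕ) : Function.Injective (S.cochainLinear n) := fun _ _ h =>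
  ModuleCat.hom_ext (S.toCochain_injective n h)

theorem cochainLinear_comp (n : ℕ)
    (f : S.resolution.complex.X n ⟶ ModuleCat.of (A ⊗[K] Aᵐᵒᵖ) A) :
    S.cochainLinear (n + 1) (S.resolution.complex.d (n + 1) n ≫ f) =
      S.coD n (S.cochainLinear n f) := by
  rw [resolution_d]
  exact S.toCochain_comp_koszulD n f.hom

theorem exists_cochainLinear_eq {n : ℕ} {m : Fin (n + 1) → A} (hm : ∀ b, S.IsHomog n (m b)) :
    ∃ f, S.cochainLinear n f = m :=
  ⟨ModuleCat.ofHom (S.ofCochain n m), S.toCochain_ofCochain hm⟩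

theorem isHomog_cochainLinear {n : ℕ}
    (f : S.resolution.complex.X n ⟶ ModuleCat.of (A ⊗[K] Aᵐᵒᵖ) A) (b : Fin (n + 1)) :
    S.IsHomog n (S.cochainLinear n f b) := S.isHomog_toCochain n f.hom b

theorem coD_cochainLinear_eq_zero {n : ℕ}
    {f : S.resolution.complex.X n ⟶ ModuleCat.of (A ⊗[K] Aᵐᵒᵖ) A} :
    S.coD n (S.cochainLinear n f) = 0 ↔ S.resolution.complex.d (n + 1) n ≫ f = 0 := by
  rw [← cochainLinear_comp, map_eq_zero_iff _ (S.cochainLinear_injective _)]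

/-- Hochschild cohomology in positive degrees, computed by cochains. -/
theorem nonempty_hochschild_linearEquiv {n : ℕ} {V : Type*} [AddCommGroup V] [Module K V]
    (F : (Fin (n + 2) → A) →ₗ[K] V)
    (surj : ∀ w, ∃ m, (∀ b, S.IsHomog (n + 1) (m b)) ∧ S.coD (n + 1) m = 0 ∧ F m = w)
    (ker : ∀ m, (∀ b, S.IsHomog (n + 1) (m b)) → S.coD (n + 1) m = 0 →
      (F m = 0 ↔ ∃ g, (∀ b, S.IsHomog n (g b)) ∧ S.coD n g = m)) :
    Nonempty (HochschildCohomology K A (n + 1) ≃ₗ[K] V) := by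
  refine S.resolution.nonempty_ext_linearEquiv (n := n) (F.comp (S.cochainLinear (n + 1))) ?_ ?_
  · intro w
    obtain ⟨m, hm, h, hw⟩ := surj w
    obtain ⟨f, rfl⟩ := S.exists_cochainLinear_eq hm
    exact ⟨f, S.coD_cochainLinear_eq_zero.1 h, hw⟩
  · intro f hf
    refine (ker _ (S.isHomog_cochainLinear f) (S.coD_cochainLinear_eq_zero.2 hf)).trans ?_
    constructor
    · rintro ⟨g, hg, h⟩
      obtain ⟨g, rfl⟩ := S.exists_cochainLinear_eq hg
      exact ⟨g, S.cochainLinear_injective _ ((S.cochainLinear_comp n g).trans h)⟩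
    · rintro ⟨g, rfl⟩
      exact ⟨_, S.isHomog_cochainLinear g, (S.cochainLinear_comp n g).symm⟩

end Hochschild

end

end QuantumCover

/-! ### Twisted cyclic differences -/

section Shift

variable {K : Type*} [Field K]

/-- The cyclic shift of functions on `ZMod 4`. -/
def cyclicShift : (ZMod 4 → K) →ₗ[K] (ZMod 4 → K) := LinearMap.funLeft K K fun i => i + 1

theorem cyclicShift_apply (f : ZMod 4 → K) (i : ZMod 4) : cyclicShift f i = f (i + 1) := rfl

theorem zmod_four_cases (i : ZMod 4) : i = 0 ∨ i = 1 ∨ i = 2 ∨ i = 3 := by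
  revert i; decide

theorem sum_cyclicShift (f : ZMod 4 → K) : ∑ i, cyclicShift f i = ∑ i, f i :=
  Equiv.sum_comp (Equiv.addRight (1 : ZMod 4)) f

/-- The operator `c S - d`, with `S` the cyclic shift. -/
def twistedDiff (c d : K) : (ZMod 4 → K) →ₗ[K] (ZMod 4 → K) := c • cyclicShift - d • LinearMap.id

theorem twistedDiff_apply (c d : K) (f : ZMod 4 → K) :
    twistedDiff c d f = c • cyclicShift f - d • f := rfl

theorem twistedDiff_comm (a b c d : K) (f : ZMod 4 → K) :
    twistedDiff a b (twistedDiff c d f) = twistedDiff c d (twistedDiff a b f) := by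
  simp only [twistedDiff_apply, map_sub, map_smul]
  module

/-- On the kernel c f(i+1) = d f(i), and four steps around the cycle give c⁴ f(i) = d⁴ f(i). -/
theorem twistedDiff_injective {c d : K} (h : c ^ 4 ≠ d ^ 4) :
    Function.Injective (twistedDiff c d) := by
  rw [injective_iff_map_eq_zero]
  intro f hf
  have h₁ (i : ZMod 4) : c * f (i + 1) = d * f i := sub_eq_zero.1 (congrFun hf i)
  ext i
  have h₂ : f (i + 1 + 1 + 1 + 1) = f i := by
    congr 1
    simp only [add_assoc]
    rw [show (1 + (1 + (1 + 1)) : ZMod 4) = 0 by decide, add_zero]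
  have h₃ := h₁ (i + 1 + 1 + 1)
  rw [h₂] at h₃
  refine (mul_eq_zero.1 (?_ : (c ^ 4 - d ^ 4) * f i = 0)).resolve_left (sub_ne_zero.2 h)
  linear_combination c ^ 3 * h₃ + c ^ 2 * d * h₁ (i + 1 + 1) + c * d ^ 2 * h₁ (i + 1) + d ^ 3 * h₁ i

theorem twistedDiff_surjective {c d : K} (h : c ^ 4 ≠ d ^ 4) :
    Function.Surjective (twistedDiff c d) :=
  LinearMap.injective_iff_surjective.1 (twistedDiff_injective h)

/-- Partial sums give a primitive, and the vanishing of the total sum closes it up around the cycle.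
-/
theorem exists_twistedDiff_one_one {g : ZMod 4 → K} (hg : ∑ i, g i = 0) :
    ∃ f, twistedDiff 1 1 f = g := by
  have hg' : g 0 + g 1 + g 2 + g 3 = 0 := (Fin.sum_univ_four (g : Fin 4 → K)).symm.trans hg
  let f : ZMod 4 → K := fun i =>
    if i = 0 then 0 else if i = 1 then g 0 else if i = 2 then g 0 + g 1 else g 0 + g 1 + g 2
  have f₀ : f 0 = 0 := rfl
  have f₁ : f 1 = g 0 := rfl
  have f₂ : f 2 = g 0 + g 1 := rfl
  have f₃ : f 3 = g 0 + g 1 + g 2 := rfl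
  refine ⟨f, funext fun i => ?_⟩
  rw [twistedDiff_apply, Pi.sub_apply, one_smul, one_smul, cyclicShift_apply]
  rcases zmod_four_cases i with rfl | rfl | rfl | rfl
  · rw [show (0 + 1 : ZMod 4) = 1 by decide, f₀, f₁, sub_zero]
  · rw [show (1 + 1 : ZMod 4) = 2 by decide, f₁, f₂, add_sub_cancel_left]
  · rw [show (2 + 1 : ZMod 4) = 3 by decide, f₂, f₃, add_sub_cancel_left]
  · rw [show (3 + 1 : ZMod 4) = 0 by decide, f₃, f₀]
    linear_combination -hg'

theorem sum_twistedDiff_one_one (f : ZMod 4 → K) : ∑ i, twistedDiff 1 1 f i = 0 := by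
  simp [twistedDiff_apply, sum_cyclicShift]

theorem eq_const_of_twistedDiff_one_one {f : ZMod 4 → K} (hf : twistedDiff 1 1 f = 0) :
    f = fun _ => f 0 := by
  have h (i : ZMod 4) : f (i + 1) = f i := by
    have := congrFun hf i
    simpa [twistedDiff_apply, cyclicShift_apply, sub_eq_zero] using this
  ext i
  have h₀ := h 0
  have h₁ := h 1
  have h₂ := h 2
  rw [show (0 + 1 : ZMod 4) = 1 by decide] at h₀
  rw [show (1 + 1 : ZMod 4) = 2 by decide] at h₁
  rw [show (2 + 1 : ZMod 4) = 3 by decide] at h₂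
  rcases zmod_four_cases i with rfl | rfl | rfl | rfl
  · rfl
  · exact h₀
  · exact h₁.trans h₀
  · exact h₂.trans (h₁.trans h₀)

/-- The Koszul complex of the two commuting operators is exact in the middle as soon as one of
them is invertible. -/
theorem exists_twistedDiff_eq {a b c d : K} (h : a ^ 4 ≠ b ^ 4 ∨ c ^ 4 ≠ d ^ 4)
    {p r : ZMod 4 → K} (hpr : twistedDiff a b r = twistedDiff c d p) :
    ∃ f, twistedDiff a b f = p ∧ twistedDiff c d f = r := by
  rcases h with h | h
  · obtain ⟨f, rfl⟩ := twistedDiff_surjective h p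
    exact ⟨f, rfl, twistedDiff_injective h (by rw [hpr, twistedDiff_comm])⟩
  · obtain ⟨f, rfl⟩ := twistedDiff_surjective h r
    exact ⟨f, twistedDiff_injective h (by rw [← hpr, twistedDiff_comm]), rfl⟩

end Shift

namespace QuantumCover

noncomputable section

/-! ### Homogeneous elements in diagonal coordinates -/

section Diagonal

variable {K A : Type*} [Field K] [Ring A] [Algebra K A] {ρ : K} (S : QuantumCover K A ρ)

/-- The diagonal elements. -/
def dg : (ZMod 4 → K) →ₗ[K] A := Fintype.linearCombination K S.e

theorem dg_apply (f : ZMod 4 → K) : S.dg f = ∑ i, f i • S.e i := rfl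

/-- Since e_i u = u e_{i+1}, passing `u` moves a diagonal element by one vertex; this is where the
cyclic shift comes from. -/
theorem u_mul_dg (f : ZMod 4 → K) : S.u * S.dg f = S.dg (cyclicShift f) * S.u := by
  rw [dg_apply, dg_apply, Finset.mul_sum, Finset.sum_mul,
    ← Equiv.sum_comp (Equiv.addRight (1 : ZMod 4)) fun i => S.u * f i • S.e i]
  simp [cyclicShift_apply, S.e_mul_u]

theorem v_mul_dg (f : ZMod 4 → K) : S.v * S.dg f = S.dg (cyclicShift f) * S.v := by
  rw [dg_apply, dg_apply, Finset.mul_sum, Finset.sum_mul,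
    ← Equiv.sum_comp (Equiv.addRight (1 : ZMod 4)) fun i => S.v * f i • S.e i]
  simp [cyclicShift_apply, S.e_mul_v]

theorem coord_dg_mul (m : Fin 4) (t : A) (n : Fin 4)
    (ht : ∀ i, S.coord m (S.e i * t) = if m = n then Pi.single i 1 else 0) (f : ZMod 4 → K) :
    S.coord m (S.dg f * t) = if m = n then f else 0 := by
  rw [dg_apply, Finset.sum_mul, map_sum]
  simp only [smul_mul_assoc, map_smul, ht]
  split_ifs
  · ext j
    simp [Finset.sum_apply, Pi.single_apply]
  · simp

theorem coord_dg (m : Fin 4) (f : ZMod 4 → K) : S.coord m (S.dg f) = if m = 0 then f else 0 := by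
  rw [← mul_one (S.dg f)]
  exact S.coord_dg_mul m 1 0 (fun i => by rw [mul_one, coord_e]) f

theorem coord_dg_mul_u (m : Fin 4) (f : ZMod 4 → K) :
    S.coord m (S.dg f * S.u) = if m = 1 then f else 0 :=
  S.coord_dg_mul m _ 1 (S.coord_e_mul_u m) f

theorem coord_dg_mul_v (m : Fin 4) (f : ZMod 4 → K) :
    S.coord m (S.dg f * S.v) = if m = 2 then f else 0 :=
  S.coord_dg_mul m _ 2 (S.coord_e_mul_v m) f

theorem coord_dg_mul_uv (m : Fin 4) (f : ZMod 4 → K) :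
    S.coord m (S.dg f * (S.u * S.v)) = if m = 3 then f else 0 :=
  S.coord_dg_mul m _ 3 (S.coord_e_mul_uv m) f

theorem dg_mul_u_add_dg_mul_v {p r : ZMod 4 → K} (h : S.dg p * S.u + S.dg r * S.v = 0) :
    p = 0 ∧ r = 0 :=
  ⟨by simpa [coord_dg_mul_u, coord_dg_mul_v] using congrArg (S.coord 1) h,
    by simpa [coord_dg_mul_u, coord_dg_mul_v] using congrArg (S.coord 2) h⟩

theorem dg_mul_uv_eq_zero {f : ZMod 4 → K} (h : S.dg f * (S.u * S.v) = 0) : f = 0 := by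
  simpa [coord_dg_mul_uv] using congrArg (S.coord 3) h

theorem eq_sum_coord (z : A) : z = S.dg (S.coord 0 z) + S.dg (S.coord 1 z) * S.u +
    S.dg (S.coord 2 z) * S.v + S.dg (S.coord 3 z) * (S.u * S.v) := by
  conv_lhs => rw [← S.basis.sum_repr z, Fintype.sum_prod_type]
  simp only [Fin.sum_univ_four, S.basis_zero, S.basis_one, S.basis_two, S.basis_three,
    Finset.sum_add_distrib, dg_apply, Finset.sum_mul, smul_mul_assoc]
  rfl

/-- An element `t` of degree d carries e_i to e_{i+d}, which meets e_{i+n} only when n ≡ d mod 4. -/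
theorem sum_e_mul_dg_mul (f : ZMod 4 → K) (n : ℕ) (d : ZMod 4) (t : A)
    (ht : ∀ i, S.e i * t = t * S.e (i + d)) :
    ∑ i, S.e i * (S.dg f * t) * S.e (i + n) = if (n : ZMod 4) = d then S.dg f * t else 0 := by
  have h (i : ZMod 4) : S.e i * (S.dg f * t) * S.e (i + n) =
      if (n : ZMod 4) = d then f i • S.e i * t else 0 := by
    have h₁ : S.e i * S.dg f = f i • S.e i := by
      simp [dg_apply, Finset.mul_sum, S.e_mul_e]
    rw [← mul_assoc, h₁, smul_mul_assoc, smul_mul_assoc, ht, mul_assoc, S.e_mul_e]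
    by_cases hn : (n : ZMod 4) = d
    · simp [hn]
    · simp [hn, Ne.symm hn]
  simp only [h]
  split_ifs
  · rw [dg_apply, Finset.sum_mul]
  · simp

theorem e_mul_uv (i : ZMod 4) : S.e i * (S.u * S.v) = S.u * S.v * S.e (i + 2) := by
  rw [← mul_assoc, S.e_mul_u, mul_assoc, S.e_mul_v, mul_assoc, add_assoc]
  rfl

/-- Apply the projection to degree n to the monomial expansion: the monomials have degrees 0, 1, 1,
2, so n mod 4 decides which of them survive. -/
theorem isHomog_eq {n : ℕ} {z : A} (hz : S.IsHomog n z) :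
    z = (if (n : ZMod 4) = 0 then S.dg (S.coord 0 z) else 0) +
      (if (n : ZMod 4) = 1 then S.dg (S.coord 1 z) * S.u else 0) +
      (if (n : ZMod 4) = 1 then S.dg (S.coord 2 z) * S.v else 0) +
      (if (n : ZMod 4) = 2 then S.dg (S.coord 3 z) * (S.u * S.v) else 0) := by
  have h₀ := S.sum_e_mul_dg_mul (S.coord 0 z) n 0 1 (by simp)
  rw [mul_one] at h₀
  rw [← h₀, ← S.sum_e_mul_dg_mul (S.coord 1 z) n 1 S.u S.e_mul_u,
    ← S.sum_e_mul_dg_mul (S.coord 2 z) n 1 S.v S.e_mul_v,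
    ← S.sum_e_mul_dg_mul (S.coord 3 z) n 2 (S.u * S.v) S.e_mul_uv, ← Finset.sum_add_distrib,
    ← Finset.sum_add_distrib, ← Finset.sum_add_distrib]
  conv_lhs => rw [← hz]
  refine Finset.sum_congr rfl fun i _ => ?_
  rw [← add_mul, ← add_mul, ← add_mul, ← mul_add, ← mul_add, ← mul_add, ← S.eq_sum_coord z]

theorem isHomog_dg (f : ZMod 4 → K) {n : ℕ} (hn : (n : ZMod 4) = 0) : S.IsHomog n (S.dg f) := by
  have h := S.sum_e_mul_dg_mul f n 0 1 (by simp)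
  rwa [mul_one, if_pos hn] at h

theorem isHomog_dg_mul_u (f : ZMod 4 → K) {n : ℕ} (hn : (n : ZMod 4) = 1) :
    S.IsHomog n (S.dg f * S.u) := by
  rw [IsHomog, S.sum_e_mul_dg_mul f n 1 S.u S.e_mul_u, if_pos hn]

theorem isHomog_dg_mul_v (f : ZMod 4 → K) {n : ℕ} (hn : (n : ZMod 4) = 1) :
    S.IsHomog n (S.dg f * S.v) := by
  rw [IsHomog, S.sum_e_mul_dg_mul f n 1 S.v S.e_mul_v, if_pos hn]

theorem isHomog_dg_mul_uv (f : ZMod 4 → K) {n : ℕ} (hn : (n : ZMod 4) = 2) :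
    S.IsHomog n (S.dg f * (S.u * S.v)) := by
  rw [IsHomog, S.sum_e_mul_dg_mul f n 2 (S.u * S.v) S.e_mul_uv, if_pos hn]

variable {S} in
theorem IsHomog.eq_dg {n : ℕ} {z : A} (hz : S.IsHomog n z) (hn : (n : ZMod 4) = 0) :
    z = S.dg (S.coord 0 z) := by
  have := S.isHomog_eq hz
  rwa [if_pos hn, if_neg (by rw [hn]; decide), if_neg (by rw [hn]; decide),
    if_neg (by rw [hn]; decide), add_zero, add_zero, add_zero] at this

variable {S} in
theorem IsHomog.eq_dg_mul_u_add {n : ℕ} {z : A} (hz : S.IsHomog n z) (hn : (n : ZMod 4) = 1) :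
    z = S.dg (S.coord 1 z) * S.u + S.dg (S.coord 2 z) * S.v := by
  have := S.isHomog_eq hz
  rwa [if_neg (by rw [hn]; decide), if_pos hn, if_pos hn,
    if_neg (by rw [hn]; decide), zero_add, add_zero] at this

variable {S} in
theorem IsHomog.eq_dg_mul_uv {n : ℕ} {z : A} (hz : S.IsHomog n z) (hn : (n : ZMod 4) = 2) :
    z = S.dg (S.coord 3 z) * (S.u * S.v) := by
  have := S.isHomog_eq hz
  rwa [if_neg (by rw [hn]; decide), if_neg (by rw [hn]; decide), if_neg (by rw [hn]; decide),
    if_pos hn, zero_add, add_zero, zero_add] at this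

variable {S} in
theorem IsHomog.eq_zero {n : ℕ} {z : A} (hz : S.IsHomog n z) (hn : (n : ZMod 4) = 3) : z = 0 := by
  have := S.isHomog_eq hz
  rwa [if_neg (by rw [hn]; decide), if_neg (by rw [hn]; decide), if_neg (by rw [hn]; decide),
    if_neg (by rw [hn]; decide), zero_add, add_zero, zero_add] at this

/-! #### The codifferential in coordinates -/

theorem coU_dg {n : ℕ} (hn : Even n) (b : ℕ) (f : ZMod 4 → K) :
    S.coU n b (S.dg f) = S.dg (twistedDiff (ρ ^ b) 1 f) * S.u := by
  rw [coU, u_mul_dg, hn.add_one.neg_one_pow, twistedDiff_apply, map_sub, map_smul, map_smul, sub_mul,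
    smul_mul_assoc, smul_mul_assoc]
  module

theorem coV_dg {n : ℕ} (hn : Even n) (b : ℕ) (f : ZMod 4 → K) :
    S.coV n b (S.dg f) = S.dg (twistedDiff 1 (ρ ^ (n - b)) f) * S.v := by
  rw [coV, v_mul_dg, hn.add_one.neg_one_pow, twistedDiff_apply, map_sub, map_smul, map_smul, sub_mul,
    smul_mul_assoc, smul_mul_assoc]
  module

/-- The `p` part dies because u² = 0; on the `r` part, reordering vu produces the coefficient ρ. For
`coV` the roles are exchanged, and the reordering also produces the overall sign. -/
theorem coU_dg_mul {n : ℕ} (hn : Odd n) (b : ℕ) (p r : ZMod 4 → K) :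
    S.coU n b (S.dg p * S.u + S.dg r * S.v) =
      S.dg (twistedDiff (ρ ^ b) ρ r) * (S.u * S.v) := by
  rw [coU, hn.add_one.neg_one_pow, twistedDiff_apply, map_sub, map_smul, map_smul, sub_mul,
    mul_add, ← mul_assoc, ← mul_assoc, u_mul_dg, u_mul_dg, mul_assoc, S.u_mul_u, mul_zero, zero_add,
    add_mul, mul_assoc _ S.u S.u, S.u_mul_u, mul_zero, zero_add, mul_assoc _ S.v S.u, S.v_mul_u,
    smul_mul_assoc, smul_mul_assoc, mul_neg, mul_smul_comm, mul_assoc]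
  module

theorem coV_dg_mul {n : ℕ} (hn : Odd n) (b : ℕ) (p r : ZMod 4 → K) :
    S.coV n b (S.dg p * S.u + S.dg r * S.v) =
      -(S.dg (twistedDiff ρ (ρ ^ (n - b)) p) * (S.u * S.v)) := by
  rw [coV, hn.add_one.neg_one_pow, twistedDiff_apply, map_sub, map_smul, map_smul, sub_mul,
    mul_add, ← mul_assoc, ← mul_assoc, v_mul_dg, v_mul_dg, mul_assoc, S.v_mul_u, mul_neg,
    mul_assoc _ S.v S.v, S.v_mul_v, mul_zero, add_zero,
    add_mul, mul_assoc _ S.v S.v, S.v_mul_v, mul_zero, add_zero, mul_assoc _ S.u S.v,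
    smul_mul_assoc, smul_mul_assoc, mul_smul_comm]
  module

end Diagonal

end

end QuantumCover

namespace QuantumCover

noncomputable section

/-! ### Exactness of the cochain complex in degrees at least three -/

section Exactness

variable {K A : Type*} [Field K] [Ring A] [Algebra K A] {ρ : K} (S : QuantumCover K A ρ)

/-- To exhibit a primitive, the target is split as `x + y`, with `x` hit by the u-parts and `y` by
the v-parts. The u-parts never reach the last component and the v-parts never reach component 0. -/
theorem coD_eq_of {n : ℕ} {g : Fin (n + 1) → A} {m x y : Fin (n + 2) → A}
    (hm : ∀ c, m c = x c + y c)
    (hx : ∀ b : Fin (n + 1), S.coU n b (g b) = x b.castSucc) (hx' : x (Fin.last _) = 0)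
    (hy : ∀ b : Fin (n + 1), S.coV n b (g b) = y b.succ) (hy' : y 0 = 0) : S.coD n g = m := by
  ext c
  rw [hm, coD, Pi.add_apply]
  congr 1
  · cases c using Fin.lastCases with
    | last => rw [Fin.snoc_last, hx']
    | cast b => rw [Fin.snoc_castSucc, hx]
  · cases c using Fin.cases with
    | zero => rw [Fin.cons_zero, hy']
    | succ b => rw [Fin.cons_succ, hy]

theorem coD_zero_right (n : ℕ) : S.coD n 0 = 0 :=
  S.coD_eq_of (x := 0) (y := 0) (by simp) (by simp [coU]) rfl (by simp [coV]) rfl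

/-- Cocycles of degree divisible by `4` vanish. -/
theorem eq_zero_of_coD_eq_zero (hρ : ∀ a b : ℕ, a ≠ b → (ρ ^ a) ^ 4 ≠ (ρ ^ b) ^ 4) {n : ℕ}
    (hn : 4 ∣ n + 1) {m : Fin (n + 2) → A} (hm : ∀ b, S.IsHomog (n + 1) (m b))
    (h : S.coD (n + 1) m = 0) : m = 0 := by
  have hn' : ((n + 1 : ℕ) : ZMod 4) = 0 := (ZMod.natCast_eq_zero_iff _ _).2 hn
  have he : Even (n + 1) := even_iff_two_dvd.2 (dvd_trans (by norm_num) hn)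
  have hmid (b : Fin (n + 1)) := congrFun h b.succ.castSucc
  simp only [coD_succ_castSucc, Pi.zero_apply] at hmid
  have hdg (b : Fin (n + 2)) := (hm b).eq_dg hn'
  ext b
  rw [Pi.zero_apply, hdg]
  suffices hf : S.coord 0 (m b) = 0 by rw [hf, map_zero]
  -- Component 0 is detected by its v-part, with operator S - ρ^(n+1), and component b+1 by its
  -- u-part, with operator ρ^(b+1) S - 1. Both operators are invertible because the exponents are
  -- positive.
  cases b using Fin.cases with
  | zero =>
    have h0 := hmid 0
    rw [hdg, hdg (Fin.castSucc 0), S.coU_dg he, S.coV_dg he] at h0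
    refine twistedDiff_injective ?_ ((S.dg_mul_u_add_dg_mul_v h0).2.trans (map_zero _).symm)
    simpa using hρ 0 (n + 1) (by omega)
  | succ b =>
    have h0 := hmid b
    rw [hdg, hdg b.castSucc, S.coU_dg he, S.coV_dg he] at h0
    refine twistedDiff_injective ?_ ((S.dg_mul_u_add_dg_mul_v h0).1.trans (map_zero _).symm)
    simpa using hρ (b + 1) 0 (by omega)

/-- The coordinates of cocycles of degree congruent to `1` modulo `4`. -/
theorem coord_of_coD_eq_zero (hρ : ∀ a b : ℕ, a ≠ b → (ρ ^ a) ^ 4 ≠ (ρ ^ b) ^ 4) {n : ℕ}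
    (hn : 4 ∣ n) {m : Fin (n + 2) → A} (hm : ∀ b, S.IsHomog (n + 1) (m b))
    (h : S.coD (n + 1) m = 0) :
    S.coord 2 (m 0) = 0 ∧ S.coord 1 (m (Fin.last _)) = 0 ∧ ∀ b : Fin (n + 1),
      twistedDiff (ρ ^ (b : ℕ)) 1 (S.coord 2 (m b.succ)) =
        twistedDiff 1 (ρ ^ (n - b)) (S.coord 1 (m b.castSucc)) := by
  have hρ0 : ρ ≠ 0 := by
    rintro rfl
    exact hρ 1 2 (by norm_num) (by simp)
  have hn' : ((n + 1 : ℕ) : ZMod 4) = 1 := by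
    rw [Nat.cast_succ, (ZMod.natCast_eq_zero_iff _ _).2 hn, zero_add]
  have ho : Odd (n + 1) := (even_iff_two_dvd.2 (dvd_trans (by norm_num) hn)).add_one
  have hdg (b : Fin (n + 2)) := (hm b).eq_dg_mul_u_add hn'
  refine ⟨?_, ?_, fun b => ?_⟩
  -- The two end components each involve a single operator, S - ρ here and ρS - 1 at the other end,
  -- both invertible.
  · have h0 := congrFun h 0
    rw [coD_zero, hdg, S.coU_dg_mul ho] at h0
    refine twistedDiff_injective ?_ ((S.dg_mul_uv_eq_zero h0).trans (map_zero _).symm)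
    simpa using hρ 0 1 (by norm_num)
  · have h0 := congrFun h (Fin.last _)
    rw [coD_last, hdg, S.coV_dg_mul ho] at h0
    refine twistedDiff_injective ?_
      ((S.dg_mul_uv_eq_zero (neg_eq_zero.1 h0)).trans (map_zero _).symm)
    simpa using hρ 1 0 (by norm_num)
  · have h0 := congrFun h b.succ.castSucc
    rw [coD_succ_castSucc, hdg, hdg b.castSucc, S.coU_dg_mul ho, S.coV_dg_mul ho, ← sub_eq_add_neg,
      ← sub_mul, ← map_sub] at h0
    have h1 := S.dg_mul_uv_eq_zero h0
    rw [← sub_eq_zero]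
    -- The cocycle equation has a common factor ρ: ρ^(b+1) S - ρ = ρ(ρ^b S - 1) and ρS - ρ^(n-b+1) =
    -- ρ(S - ρ^(n-b)).
    refine (smul_eq_zero.1 ?_).resolve_left hρ0
    rw [← h1]
    simp only [twistedDiff_apply]
    rw [show n + 1 - b = n - b + 1 by omega]
    module

theorem coD_dg_eq {n : ℕ} (hn : 4 ∣ n) {m : Fin (n + 2) → A} (hm : ∀ b, S.IsHomog (n + 1) (m b))
    (h₀ : S.coord 2 (m 0) = 0) (h₁ : S.coord 1 (m (Fin.last _)) = 0) {f : Fin (n + 1) → ZMod 4 → K}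
    (hf : ∀ b : Fin (n + 1), twistedDiff (ρ ^ (b : ℕ)) 1 (f b) = S.coord 1 (m b.castSucc))
    (hf' : ∀ b : Fin (n + 1), twistedDiff 1 (ρ ^ (n - b)) (f b) = S.coord 2 (m b.succ)) :
    S.coD n (fun b => S.dg (f b)) = m := by
  have hn' : ((n + 1 : ℕ) : ZMod 4) = 1 := by
    rw [Nat.cast_succ, (ZMod.natCast_eq_zero_iff _ _).2 hn, zero_add]
  have he : Even n := even_iff_two_dvd.2 (dvd_trans (by norm_num) hn)
  refine S.coD_eq_of (fun c => (hm c).eq_dg_mul_u_add hn') (fun b => ?_) ?_ (fun b => ?_) ?_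
  · rw [S.coU_dg he, hf]
  · rw [h₁, map_zero, zero_mul]
  · rw [S.coV_dg he, hf']
  · rw [h₀, map_zero, zero_mul]

/-- The cocycle equations decouple into one Koszul square for each b, with operators ρ^b S - 1 and S
- ρ^(n-b). The first is invertible if b ≠ 0, and the second if b = 0, because n ≠ 0. -/
theorem exists_coD_eq_of_degree_one (hρ : ∀ a b : ℕ, a ≠ b → (ρ ^ a) ^ 4 ≠ (ρ ^ b) ^ 4) {n : ℕ}
    (hn : 4 ∣ n) (hn0 : n ≠ 0) {m : Fin (n + 2) → A} (hm : ∀ b, S.IsHomog (n + 1) (m b))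
    (h : S.coD (n + 1) m = 0) : ∃ g, (∀ b, S.IsHomog n (g b)) ∧ S.coD n g = m := by
  obtain ⟨h₀, h₁, h₂⟩ := S.coord_of_coD_eq_zero hρ hn hm h
  have key (b : Fin (n + 1)) := exists_twistedDiff_eq (by
    rcases eq_or_ne (b : ℕ) 0 with hb | hb
    · right
      simpa using hρ 0 (n - b) (by omega)
    · left
      simpa using hρ b 0 hb) (h₂ b)
  choose f hf hf' using key
  exact ⟨_, fun b => S.isHomog_dg _ ((ZMod.natCast_eq_zero_iff _ _).2 hn),
    S.coD_dg_eq hn hm h₀ h₁ hf hf'⟩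

theorem coD_dg_mul_eq {n : ℕ} (hn : (n : ZMod 4) = 1) (ho : Odd n) {m : Fin (n + 2) → A}
    (hm : ∀ b, S.IsHomog (n + 1) (m b)) {p r : Fin (n + 1) → ZMod 4 → K}
    {x y : Fin (n + 2) → ZMod 4 → K} (hxy : ∀ c, S.coord 3 (m c) = x c + y c)
    (hr : ∀ b : Fin (n + 1), twistedDiff (ρ ^ (b : ℕ)) ρ (r b) = x b.castSucc)
    (hx : x (Fin.last _) = 0)
    (hp : ∀ b : Fin (n + 1), twistedDiff ρ (ρ ^ (n - b)) (p b) = -y b.succ) (hy : y 0 = 0) :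
    S.coD n (fun b => S.dg (p b) * S.u + S.dg (r b) * S.v) = m := by
  have hn' : ((n + 1 : ℕ) : ZMod 4) = 2 := by
    rw [Nat.cast_succ, hn]; decide
  refine S.coD_eq_of (x := fun c => S.dg (x c) * (S.u * S.v))
    (y := fun c => S.dg (y c) * (S.u * S.v)) (fun c => ?_) (fun b => ?_) ?_ (fun b => ?_) ?_
  · rw [← add_mul, ← map_add, ← hxy]
    exact (hm c).eq_dg_mul_uv hn'
  · rw [S.coU_dg_mul ho, hr]
  · rw [hx, map_zero, zero_mul]
  · rw [S.coV_dg_mul ho, hp, map_neg, neg_mul, neg_neg]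
  · rw [hy, map_zero, zero_mul]

/-- Component c can be reached by solving for r_c unless c is 1 or n + 1, and by solving for p_(c-1)
unless c is 0 or n. As n ≠ 1, these exceptions are disjoint, so p is used exactly for c = 1 and c =
n + 1. -/
theorem exists_coD_eq_of_degree_two (hρ : ∀ a b : ℕ, a ≠ b → (ρ ^ a) ^ 4 ≠ (ρ ^ b) ^ 4) {n : ℕ}
    (hn : (n : ZMod 4) = 1) (ho : Odd n) (hn1 : n ≠ 1) {m : Fin (n + 2) → A}
    (hm : ∀ b, S.IsHomog (n + 1) (m b)) : ∃ g, (∀ b, S.IsHomog n (g b)) ∧ S.coD n g = m := by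
  have hr (b : Fin (n + 1)) (hb : (b : ℕ) ≠ 1) :=
    twistedDiff_surjective (c := ρ ^ (b : ℕ)) (d := ρ) (by simpa using hρ b 1 hb)
      (S.coord 3 (m b.castSucc))
  have hp (b : Fin (n + 1)) (hb : n - b ≠ 1) :=
    twistedDiff_surjective (c := ρ) (d := ρ ^ (n - b)) (by simpa using hρ 1 (n - b) hb.symm)
      (-S.coord 3 (m b.succ))
  choose r hr using hr
  choose p hp using hp
  refine ⟨_, fun b => ?_, S.coD_dg_mul_eq hn ho hm
    (x := fun c => if (c : ℕ) = 1 ∨ (c : ℕ) = n + 1 then 0 else S.coord 3 (m c))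
    (y := fun c => if (c : ℕ) = 1 ∨ (c : ℕ) = n + 1 then S.coord 3 (m c) else 0)
    (r := fun b => if hb : (b : ℕ) ≠ 1 then r b hb else 0)
    (p := fun b => if hb : (b : ℕ) = 0 ∨ (b : ℕ) = n then p b (by omega) else 0)
    (fun c => ?_) (fun b => ?_) ?_ (fun b => ?_) ?_⟩
  · exact (S.isHomog_dg_mul_u _ hn).add (S.isHomog_dg_mul_v _ hn)
  · split_ifs <;> simp
  · have : (b : ℕ) ≠ n + 1 := by omega
    by_cases hb : (b : ℕ) = 1
    · simp [hb]
    · simp [hb, this, hr b hb]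
  · simp
  · by_cases hb : (b : ℕ) = 0 ∨ (b : ℕ) = n
    · rw [dif_pos hb, hp, if_pos (by rw [Fin.val_succ]; omega)]
    · rw [dif_neg hb, if_neg (by rw [Fin.val_succ]; omega), map_zero, neg_zero]
  · simp

/-- The residue of n mod 4 selects the argument. The bound 2 ≤ n rules out n = 0 and n = 1, the
degrees where the one singular square contributes. -/
theorem exists_coD_eq (hρ : ∀ a b : ℕ, a ≠ b → (ρ ^ a) ^ 4 ≠ (ρ ^ b) ^ 4) {n : ℕ}
    (hn : 2 ≤ n) {m : Fin (n + 2) → A} (hm : ∀ b, S.IsHomog (n + 1) (m b))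
    (h : S.coD (n + 1) m = 0) : ∃ g, (∀ b, S.IsHomog n (g b)) ∧ S.coD n g = m := by
  have hmod : n % 4 = 0 ∨ n % 4 = 1 ∨ n % 4 = 2 ∨ n % 4 = 3 := by omega
  rcases hmod with h0 | h1 | h2 | h3
  · exact S.exists_coD_eq_of_degree_one hρ (Nat.dvd_of_mod_eq_zero h0) (by omega) hm h
  · have hn : (n : ZMod 4) = 1 := (ZMod.natCast_eq_natCast_iff n 1 4).2 h1
    exact S.exists_coD_eq_of_degree_two hρ hn (Nat.odd_iff.2 (by omega)) (by omega) hm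
  · have hn : ((n + 1 : ℕ) : ZMod 4) = 3 :=
      (ZMod.natCast_eq_natCast_iff (n + 1) 3 4).2 (by unfold Nat.ModEq; omega)
    refine ⟨0, fun b => IsHomog.zero S n, ?_⟩
    rw [coD_zero_right]
    ext b
    exact ((hm b).eq_zero hn).symm
  · rw [S.eq_zero_of_coD_eq_zero hρ (Nat.dvd_of_mod_eq_zero (by omega)) hm h]
    exact ⟨0, fun b => IsHomog.zero S n, S.coD_zero_right n⟩

end Exactness

/-! ### The Hochschild cohomology groups of the cover -/

section Hochschild

open CategoryTheory

variable {K A : Type u} [Field K] [Ring A] [Algebra K A] {ρ : K}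

theorem subsingleton_hochschild (S : QuantumCover K A ρ)
    (hρ : ∀ a b : ℕ, a ≠ b → (ρ ^ a) ^ 4 ≠ (ρ ^ b) ^ 4) {n : ℕ} (hn : 3 ≤ n) : Subsingleton (HochschildCohomology K A n) := by
  obtain ⟨n, rfl⟩ := Nat.exists_eq_add_of_le' (show 1 ≤ n by omega)
  obtain ⟨e⟩ := S.nonempty_hochschild_linearEquiv (n := n) (V := PUnit.{1}) 0
    (fun w => ⟨0, fun b => IsHomog.zero S _, S.coD_zero_right _, rfl⟩)
    (fun m hm h => ⟨fun _ => S.exists_coD_eq hρ (by omega) hm h, fun _ => rfl⟩)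
  exact e.toEquiv.subsingleton

/-- Both operators of the single square are S - 1. Cocycles are the pairs (p_0, r_1) with r_1 - p_0
constant, and coboundaries have p_0 = r_1 = (S - 1) f. The class is therefore recorded by the sum of
p_0 and the constant r_1 - p_0. -/
theorem nonempty_hochschild_one (S : QuantumCover K A ρ)
    (hρ : ∀ a b : ℕ, a ≠ b → (ρ ^ a) ^ 4 ≠ (ρ ^ b) ^ 4) :
    Nonempty (HochschildCohomology K A 1 ≃ₗ[K] K × K) := by
  let F : (Fin 2 → A) →ₗ[K] K × K := LinearMap.prod
    ((∑ i, LinearMap.proj i).comp ((S.coord 1).comp (LinearMap.proj 0)))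
    ((LinearMap.proj 0).comp ((S.coord 2).comp (LinearMap.proj 1)) -
      (LinearMap.proj 0).comp ((S.coord 1).comp (LinearMap.proj 0)))
  have hF (m : Fin 2 → A) : F m =
      (∑ i, S.coord 1 (m 0) i, S.coord 2 (m 1) 0 - S.coord 1 (m 0) 0) := by
    simp [F]
  refine S.nonempty_hochschild_linearEquiv (n := 0) F ?_ ?_
  · rintro ⟨s, t⟩
    -- The representative has p_0 = σ, of sum s and supported at one vertex, and r_1 = τ, which
    -- differs from σ by the constant t.
    let σ : ZMod 4 → K := Pi.single 0 s
    let τ : ZMod 4 → K := σ + fun _ => t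
    have hτ : twistedDiff ρ ρ τ = twistedDiff ρ ρ σ := by
      ext i; simp [τ, twistedDiff_apply, cyclicShift_apply]
    let p : Fin 2 → ZMod 4 → K := ![σ, 0]
    let r : Fin 2 → ZMod 4 → K := ![0, τ]
    refine ⟨fun b => S.dg (p b) * S.u + S.dg (r b) * S.v, fun b => ?_, ?_, ?_⟩
    · exact (S.isHomog_dg_mul_u _ (by simp)).add (S.isHomog_dg_mul_v _ (by simp))
    -- The target is zero: the contributions of τ and σ to component 1 are opposite.
    · refine S.coD_dg_mul_eq (n := 1) (by simp) odd_one (fun b => IsHomog.zero S _)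
        (x := ![0, twistedDiff ρ ρ σ, 0]) (y := ![0, -twistedDiff ρ ρ σ, 0]) ?_ ?_ rfl ?_ rfl
      · intro c; fin_cases c <;> simp
      · intro b; fin_cases b <;> simp [r, hτ]
      · intro b; fin_cases b <;> simp [p]
    · rw [hF]
      have h : S.coord 2 (S.dg τ * S.v) 0 = s + t := by
        rw [coord_dg_mul_v, if_pos rfl]
        simp [τ, σ]
      simp [p, r, coord_dg_mul_u, h, σ]
  · intro m hm h
    obtain ⟨h₀, h₁, h₂⟩ := S.coord_of_coD_eq_zero hρ (n := 0) (by norm_num) hm h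
    have h₂ : twistedDiff 1 1 (S.coord 2 (m 1)) = twistedDiff 1 1 (S.coord 1 (m 0)) := by
      simpa using h₂ 0
    rw [hF, Prod.mk_eq_zero]
    constructor
    · rintro ⟨hs, h0⟩
      have hc := eq_const_of_twistedDiff_one_one
        (f := S.coord 2 (m 1) - S.coord 1 (m 0)) (by rw [map_sub, h₂, sub_self])
      simp only [Pi.sub_apply, h0] at hc
      obtain ⟨f, hf⟩ := exists_twistedDiff_one_one hs
      refine ⟨_, fun b => S.isHomog_dg _ (by simp),
        S.coD_dg_eq (n := 0) (by norm_num) hm h₀ h₁ (f := fun _ => f) (fun b => ?_) fun b => ?_⟩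
      · obtain rfl := Fin.eq_zero b
        simpa using hf
      · obtain rfl := Fin.eq_zero b
        simpa [hf] using (sub_eq_zero.1 hc).symm
    · rintro ⟨g, hg, rfl⟩
      have h0 : S.coD 0 g 0 = S.dg (twistedDiff 1 1 (S.coord 0 (g 0))) * S.u := by
        rw [coD_zero, (hg 0).eq_dg (by simp), S.coU_dg (by simp), coord_dg]
        simp
      have h1 : S.coD 0 g 1 = S.dg (twistedDiff 1 1 (S.coord 0 (g 0))) * S.v := by
        refine (S.coD_last 0 g).trans ?_
        rw [(hg (Fin.last 0)).eq_dg (by simp), S.coV_dg (by simp)]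
        simp
      rw [h0, h1, coord_dg_mul_u, coord_dg_mul_v, if_pos rfl, if_pos rfl, sub_self]
      exact ⟨sum_twistedDiff_one_one _, rfl⟩

/-- Components 0 and 2 are filled by the invertible operators S - ρ and ρS - 1. Component 1 is
reached only through ρ(S - 1), whose image consists of the functions of sum zero. -/
theorem nonempty_hochschild_two (S : QuantumCover K A ρ)
    (hρ : ∀ a b : ℕ, a ≠ b → (ρ ^ a) ^ 4 ≠ (ρ ^ b) ^ 4) :
    Nonempty (HochschildCohomology K A 2 ≃ₗ[K] K) := by
  have hρ0 : ρ ≠ 0 := by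
    rintro rfl
    exact hρ 1 2 (by norm_num) (by simp)
  let F : (Fin 3 → A) →ₗ[K] K :=
    (∑ i, LinearMap.proj i).comp ((S.coord 3).comp (LinearMap.proj 1))
  have hF (m : Fin 3 → A) : F m = ∑ i, S.coord 3 (m 1) i := by
    simp [F]
  refine S.nonempty_hochschild_linearEquiv (n := 1) F (fun w => ?_) fun m hm _ => ?_
  · have hm (b : Fin 3) : S.IsHomog 2 (S.dg (Pi.single 0 w) * (S.u * S.v)) :=
      S.isHomog_dg_mul_uv _ (by simp)
    refine ⟨fun _ => S.dg (Pi.single 0 w) * (S.u * S.v), hm, ?_, ?_⟩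
    -- There are no nonzero cochains in degree 3, so every 2-cochain is a cocycle.
    · ext c
      exact (S.isHomog_coD hm c).eq_zero (by simp)
    · rw [hF]
      simp [coord_dg_mul_uv]
  · rw [hF]
    constructor
    · intro hs
      obtain ⟨r₀, hr₀⟩ := twistedDiff_surjective (c := 1) (d := ρ)
        (by simpa using hρ 0 1 (by norm_num)) (S.coord 3 (m 0))
      obtain ⟨p₁, hp₁⟩ := twistedDiff_surjective (c := ρ) (d := 1)
        (by simpa using hρ 1 0 (by norm_num)) (-S.coord 3 (m 2))
      obtain ⟨f, hf⟩ := exists_twistedDiff_one_one hs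
      have hr₁ : twistedDiff ρ ρ (ρ⁻¹ • f) = S.coord 3 (m 1) := by
        rw [← hf]
        simp [twistedDiff_apply, ← smul_sub, smul_smul, hρ0]
      refine ⟨_, fun b => (S.isHomog_dg_mul_u _ (by simp)).add (S.isHomog_dg_mul_v _ (by simp)),
        S.coD_dg_mul_eq (n := 1) (by simp) odd_one hm (p := ![0, p₁]) (r := ![r₀, ρ⁻¹ • f])
        (x := ![S.coord 3 (m 0), S.coord 3 (m 1), 0]) (y := ![0, 0, S.coord 3 (m 2)])
        ?_ ?_ rfl ?_ rfl⟩
      · intro c; fin_cases c <;> simp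
      · intro b; fin_cases b
        · simpa using hr₀
        · simpa using hr₁
      · intro b; fin_cases b
        · simp
        · simpa using hp₁
    · rintro ⟨g, hg, rfl⟩
      have h1 : S.coD 1 g 1 = S.dg (twistedDiff ρ ρ (S.coord 2 (g 1) - S.coord 1 (g 0))) *
          (S.u * S.v) := by
        refine (S.coD_succ_castSucc 0 g 0).trans ?_
        rw [(hg _).eq_dg_mul_u_add (by simp), (hg (Fin.castSucc 0)).eq_dg_mul_u_add (by simp),
          S.coU_dg_mul (by simp), S.coV_dg_mul (by simp)]
        simp [← sub_mul, ← sub_eq_add_neg]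
      rw [h1, coord_dg_mul_uv, if_pos rfl]
      simp only [twistedDiff_apply, Pi.sub_apply, Pi.smul_apply, Finset.sum_sub_distrib,
        ← Finset.smul_sum, sum_cyclicShift, sub_self]

/-- Commuting with the idempotents makes `z` diagonal, and commuting with `u` makes its coordinates
invariant under the shift. -/
theorem eq_smul_one_of_central {A : Type*} [Ring A] [Algebra K A] (S : QuantumCover K A ρ) {z : A}
    (hz : ∀ a, a * z = z * a) : ∃ c : K, z = c • 1 := by
  have hhom : S.IsHomog 0 z := by
    simp only [IsHomog, Nat.cast_zero, add_zero, hz, mul_assoc, S.e_mul_e, if_true]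
    rw [← Finset.mul_sum, S.sum_e, mul_one]
  have h := hhom.eq_dg (by simp)
  have hu := hz S.u
  rw [h, u_mul_dg, ← sub_eq_zero, ← sub_mul, ← map_sub] at hu
  have hc := congrArg (S.coord 1) hu
  rw [coord_dg_mul_u, if_pos rfl, map_zero] at hc
  have hconst := eq_const_of_twistedDiff_one_one (f := S.coord 0 z)
    (by rw [twistedDiff_apply, one_smul, one_smul, hc])
  refine ⟨S.coord 0 z 0, ?_⟩
  conv_lhs => rw [h, hconst]
  rw [dg_apply, ← Finset.smul_sum, S.sum_e]

/-- A bimodule endomorphism is multiplication by the image of 1, which is central. -/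
theorem exists_eq_smul_unit (S : QuantumCover K A ρ) (α : HochschildCohomology K A 0) :
    ∃ c : K, α = c • HochschildCohomology.unit K A := by
  let := instModuleTensorProductMop K A
  obtain ⟨f, rfl⟩ := (CategoryTheory.Abelian.Ext.mk₀_bijective (regularBimodule K A)
    (regularBimodule K A)).2 α
  let φ : A →ₗ[A ⊗[K] Aᵐᵒᵖ] A := f.hom
  have hl (a : A) : φ a = a * φ 1 := by
    rw [← lft_smul (K := K) a (φ 1), ← map_smul, lft_smul, mul_one]
  have hr (a : A) : φ a = φ 1 * a := by
    rw [← rgt_smul (K := K) a (φ 1), ← map_smul, rgt_smul, one_mul]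
  obtain ⟨c, hc⟩ := S.eq_smul_one_of_central (z := φ 1) fun a => (hl a).symm.trans (hr a)
  refine ⟨c, ?_⟩
  have key (a : A) : φ a = (algebraMap K (A ⊗[K] Aᵐᵒᵖ) c) • a := by
    rw [hl, hc, Algebra.algebraMap_eq_smul_one, scalar_smul_smul, one_smul, mul_smul_comm, mul_one]
  have hf : f = c • 𝟙 (regularBimodule K A) := ModuleCat.hom_ext (LinearMap.ext key)
  rw [hf]
  exact CategoryTheory.Abelian.Ext.mk₀_smul c _

theorem unit_ne_zero [Nontrivial A] : HochschildCohomology.unit K A ≠ 0 := by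
  intro h
  have h' : 𝟙 (regularBimodule K A) = 0 :=
    (CategoryTheory.Abelian.Ext.mk₀_eq_zero_iff _).1 h
  have h'' : (1 : A) = 0 := congrArg (fun f : regularBimodule K A ⟶ regularBimodule K A =>
    (f.hom (1 : A) : A)) h'
  exact one_ne_zero h''

end Hochschild

end

end QuantumCover

/-! ### Hochschild rings concentrated in degrees at most two -/

namespace HochschildRing

noncomputable section

variable {K : Type u} [Field K] {A : Type u} [Ring A] [Algebra K A]

open HochschildCohomology DirectSum

theorem eq_sum_of (vanish : ∀ n, 3 ≤ n → Subsingleton (HochschildCohomology K A n))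
    (x : HochschildRing K A) :
    x = of _ 0 (x 0) + of _ 1 (x 1) + of _ 2 (x 2) := by
  refine DFinsupp.ext fun n => ?_
  simp only [DirectSum.add_apply]
  match n with
  | 0 => simp [of_eq_same, of_eq_of_ne]
  | 1 => simp [of_eq_same, of_eq_of_ne]
  | 2 => simp [of_eq_same, of_eq_of_ne]
  | n + 3 =>
    have := vanish (n + 3) (by omega)
    exact Subsingleton.elim _ _

theorem finrank_eq_four (e₀ : HochschildCohomology K A 0 ≃ₗ[K] K)
    (e₁ : HochschildCohomology K A 1 ≃ₗ[K] K × K) (e₂ : HochschildCohomology K A 2 ≃ₗ[K] K)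
    (vanish : ∀ n, 3 ≤ n → Subsingleton (HochschildCohomology K A n)) :
    Module.finrank K (HochschildRing K A) = 4 := by
  let p (n : ℕ) := DirectSum.component K ℕ (HochschildCohomology K A) n
  let f : HochschildRing K A →ₗ[K] K × (K × K) × K :=
    (e₀.toLinearMap.comp (p 0)).prod ((e₁.toLinearMap.comp (p 1)).prod (e₂.toLinearMap.comp (p 2)))
  have hf (x : HochschildRing K A) : f x = (e₀ (x 0), e₁ (x 1), e₂ (x 2)) := rfl
  have hbij : Function.Bijective f := by
    constructor
    · rw [injective_iff_map_eq_zero]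
      intro x hx
      simp only [hf, Prod.mk_eq_zero, EmbeddingLike.map_eq_zero_iff] at hx
      rw [eq_sum_of vanish x, hx.1, hx.2.1, hx.2.2]
      simp
    · rintro ⟨a, b, c⟩
      refine ⟨of _ 0 (e₀.symm a) + of _ 1 (e₁.symm b) + of _ 2 (e₂.symm c), ?_⟩
      rw [hf]
      simp [of_eq_same, of_eq_of_ne]
  rw [(LinearEquiv.ofBijective f hbij).finrank_eq]
  simp

theorem unit_yoneda_unit : yoneda (unit K A) (unit K A) = unit K A :=
  CategoryTheory.Abelian.Ext.comp_mk₀_id (X := regularBimodule K A) (Y := regularBimodule K A)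
    (unit K A)

/-- The projection of `HHⁿ(A)` to `K`, zero in positive degrees. -/
def degreeZero (e₀ : HochschildCohomology K A 0 ≃ₗ[K] K) :
    ∀ n, HochschildCohomology K A n →ₗ[K] K
  | 0 => e₀.toLinearMap
  | _ + 1 => 0

/-- The augmentation of the Hochschild ring when `HH⁰(A) = K`. -/
def augmentation (e₀ : HochschildCohomology K A 0 ≃ₗ[K] K) (he : e₀ (unit K A) = 1) :
    HochschildRing K A →ₐ[K] K :=
  DirectSum.toAlgebra K _ (degreeZero e₀) he (by
    have h (α : HochschildCohomology K A 0) : α = e₀ α • unit K A :=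
      e₀.injective (by rw [map_smul, he, smul_eq_mul, mul_one])
    rintro (_ | i) (_ | j) α β
    · change e₀ (yoneda α β) = e₀ α * e₀ β
      have hαβ : yoneda α β = (e₀ α * e₀ β) • unit K A := by
        conv_lhs => rw [h α, h β]
        rw [smul_yoneda, yoneda_smul, smul_smul, unit_yoneda_unit]
      exact (congrArg e₀ hαβ).trans (by rw [map_smul, he, smul_eq_mul, mul_one])
    · exact (mul_zero _).symm
    · exact (zero_mul _).symm
    · exact (zero_mul _).symm)

theorem augmentation_of_zero (e₀ : HochschildCohomology K A 0 ≃ₗ[K] K) (he : e₀ (unit K A) = 1)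
    (α : HochschildCohomology K A 0) : augmentation e₀ he (of _ 0 α) = e₀ α :=
  DirectSum.toAddMonoid_of (fun i => (degreeZero e₀ i).toAddMonoidHom) 0 α

theorem augmentation_of_succ (e₀ : HochschildCohomology K A 0 ≃ₗ[K] K) (he : e₀ (unit K A) = 1)
    (n : ℕ) (α : HochschildCohomology K A (n + 1)) : augmentation e₀ he (of _ (n + 1) α) = 0 :=
  DirectSum.toAddMonoid_of (fun i => (degreeZero e₀ i).toAddMonoidHom) (n + 1) α

theorem of_mul_of_mul_of (vanish : ∀ n, 3 ≤ n → Subsingleton (HochschildCohomology K A n))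
    {i j k : ℕ} (h : 3 ≤ i + j + k) (a : HochschildCohomology K A i)
    (b : HochschildCohomology K A j) (c : HochschildCohomology K A k) :
    (of (HochschildCohomology K A) i a * of _ j b * of _ k c : HochschildRing K A) = 0 := by
  rw [of_mul_of, of_mul_of]
  have := vanish _ h
  rw [Subsingleton.elim (GradedMonoid.GMul.mul (GradedMonoid.GMul.mul a b) c) 0, map_zero]

theorem isNilpotent_of (vanish : ∀ n, 3 ≤ n → Subsingleton (HochschildCohomology K A n))
    {i : ℕ} (h : 1 ≤ i) (a : HochschildCohomology K A i) :
    IsNilpotent (of (HochschildCohomology K A) i a : HochschildRing K A) :=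
  ⟨3, by rw [pow_succ, pow_two]; exact of_mul_of_mul_of vanish (by omega) a a a⟩

theorem eq_algebraMap_add (e₀ : HochschildCohomology K A 0 ≃ₗ[K] K) (he : e₀ (unit K A) = 1)
    (vanish : ∀ n, 3 ≤ n → Subsingleton (HochschildCohomology K A n))
    (x : HochschildRing K A) :
    x = algebraMap K _ (augmentation e₀ he x) + (of _ 1 (x 1) + of _ 2 (x 2)) := by
  have h₀ : augmentation e₀ he x = e₀ (x 0) := by
    conv_lhs => rw [eq_sum_of vanish x]
    rw [map_add, map_add, augmentation_of_zero, augmentation_of_succ, augmentation_of_succ,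
      add_zero, add_zero]
  have h₁ : algebraMap K (HochschildRing K A) (e₀ (x 0)) = of _ 0 (x 0) := by
    change of _ 0 (e₀ (x 0) • unit K A) = _
    congr 1
    exact e₀.injective (by rw [map_smul, he, smul_eq_mul, mul_one])
  rw [h₀, h₁, ← add_assoc]
  exact eq_sum_of vanish x

/-- The element is a nonzero scalar plus its positive-degree part, whose cube lies in degrees at
least 3 and so vanishes. -/
theorem isUnit_of_augmentation_ne_zero
    (e₀ : HochschildCohomology K A 0 ≃ₗ[K] K) (he : e₀ (unit K A) = 1)
    (vanish : ∀ n, 3 ≤ n → Subsingleton (HochschildCohomology K A n))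
    {x : HochschildRing K A}
    (hx : augmentation e₀ he x ≠ 0) : IsUnit x := by
  rw [eq_algebraMap_add e₀ he vanish x]
  have hnil : IsNilpotent (of _ 1 (x 1) + of _ 2 (x 2) : HochschildRing K A) := by
    refine ⟨3, ?_⟩
    have h {i j k : ℕ} (h : 3 ≤ i + j + k) (a : HochschildCohomology K A i)
      (b : HochschildCohomology K A j) (c : HochschildCohomology K A k) :=
      of_mul_of_mul_of vanish h a b c
    rw [pow_succ, pow_two]
    simp only [add_mul, mul_add, h (show 3 ≤ 1 + 1 + 1 by norm_num),
      h (show 3 ≤ 1 + 1 + 2 by norm_num), h (show 3 ≤ 1 + 2 + 1 by norm_num),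
      h (show 3 ≤ 1 + 2 + 2 by norm_num), h (show 3 ≤ 2 + 1 + 1 by norm_num),
      h (show 3 ≤ 2 + 1 + 2 by norm_num), h (show 3 ≤ 2 + 2 + 1 by norm_num),
      h (show 3 ≤ 2 + 2 + 2 by norm_num), add_zero]
  exact hnil.isUnit_add_left_of_commute ((isUnit_iff_ne_zero.2 hx).map (algebraMap K _))
    (Algebra.commutes _ _).symm

theorem isLocalRing (e₀ : HochschildCohomology K A 0 ≃ₗ[K] K) (he : e₀ (unit K A) = 1)
    (vanish : ∀ n, 3 ≤ n → Subsingleton (HochschildCohomology K A n)) :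
    IsLocalRing (HochschildRing K A) where
  exists_pair_ne := ⟨0, 1, fun h => zero_ne_one (α := K) (by
    simpa using congrArg (augmentation e₀ he) h)⟩
  isUnit_or_isUnit_of_add_one {a b} hab := by
    by_cases ha : augmentation e₀ he a = 0
    · refine Or.inr (isUnit_of_augmentation_ne_zero e₀ he vanish fun hb => ?_)
      have := congrArg (augmentation e₀ he) hab
      rw [map_add, ha, hb, map_one, add_zero] at this
      exact zero_ne_one this
    · exact Or.inl (isUnit_of_augmentation_ne_zero e₀ he vanish ha)

/-- The augmentation sends nilpotents to nilpotents of the field `K`, hence to 0. -/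
theorem augmentation_eq_zero_of_mem
    (e₀ : HochschildCohomology K A 0 ≃ₗ[K] K) (he : e₀ (unit K A) = 1)
    {x : HochschildRing K A} (hx : x ∈ hochschildNilIdeal K A) :
    augmentation e₀ he x = 0 := by
  have h : hochschildNilIdeal K A ≤ TwoSidedIdeal.ker (augmentation e₀ he).toRingHom := by
    refine TwoSidedIdeal.span_le.2 ?_
    rintro y ⟨hy, -⟩
    exact (hy.map (augmentation e₀ he)).eq_zero
  exact h hx

/-- Homogeneous elements of positive degree are all nilpotent, so the ideal contains the whole
positive part and the scalars exhaust the quotient; the augmentation keeps the scalars from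
collapsing. -/
theorem nonempty_quotient_algEquiv
    (e₀ : HochschildCohomology K A 0 ≃ₗ[K] K) (he : e₀ (unit K A) = 1)
    (vanish : ∀ n, 3 ≤ n → Subsingleton (HochschildCohomology K A n)) :
    Nonempty ((hochschildNilIdeal K A).ringCon.Quotient ≃ₐ[K] K) := by
  have hmem {i : ℕ} (hi : 1 ≤ i) (a : HochschildCohomology K A i) :
      of _ i a ∈ hochschildNilIdeal K A :=
    TwoSidedIdeal.subset_span ⟨isNilpotent_of vanish hi a, i, a, rfl⟩
  refine ⟨(AlgEquiv.ofBijective (Algebra.ofId K _) ⟨?_, ?_⟩).symm⟩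
  · rw [injective_iff_map_eq_zero]
    intro c hc
    have h : (hochschildNilIdeal K A).ringCon (algebraMap K _ c) 0 := (RingCon.eq _).1 hc
    have := augmentation_eq_zero_of_mem e₀ he ((TwoSidedIdeal.mem_iff _ _).2 h)
    rwa [AlgHom.commutes] at this
  · intro y
    induction y using Quotient.inductionOn' with | h x
    refine ⟨augmentation e₀ he x, (RingCon.eq _).2 ?_⟩
    have h := (hochschildNilIdeal K A).add_mem (hmem le_rfl (x 1)) (hmem one_le_two (x 2))
    refine (hochschildNilIdeal K A).ringCon.symm ((TwoSidedIdeal.rel_iff _ _ _).2 ?_)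
    rw [← add_sub_cancel_left (algebraMap K _ (augmentation e₀ he x)) (of _ 1 (x 1) + of _ 2 (x 2)),
      ← eq_algebraMap_add e₀ he vanish x] at h
    exact h

end

end HochschildRing

/-! ### Matrix representations of path algebras -/

namespace PathAlgebra

noncomputable section

variable {K V : Type*} [Quiver V] [Field K]

theorem vertex_mul_ofPath {a b : V} (p : Quiver.Path a b) :
    vertex K a * ofPath K ⟨a, b, p⟩ = ofPath K ⟨a, b, p⟩ := by
  rw [vertex, ofPath_mul_ofPath, mulPath_of_eq, Quiver.Path.nil_comp]

theorem vertex_mul_ofPath_of_ne {v a b : V} (h : v ≠ a) (p : Quiver.Path a b) :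
    vertex K v * ofPath K ⟨a, b, p⟩ = 0 := by
  rw [vertex, ofPath_mul_ofPath, mulPath_of_ne h]

theorem ofPath_mul_vertex {a b : V} (p : Quiver.Path a b) :
    ofPath K ⟨a, b, p⟩ * vertex K b = ofPath K ⟨a, b, p⟩ := by
  rw [vertex, ofPath_mul_ofPath, mulPath_of_eq, Quiver.Path.comp_nil]

theorem ofPath_mul_vertex_of_ne {v a b : V} (h : b ≠ v) (p : Quiver.Path a b) :
    ofPath K ⟨a, b, p⟩ * vertex K v = 0 := by
  rw [vertex, ofPath_mul_ofPath, mulPath_of_ne h]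

theorem ofPath_cons {a b c : V} (p : Quiver.Path a b) (f : b ⟶ c) :
    ofPath K ⟨a, c, p.cons f⟩ = ofPath K ⟨a, b, p⟩ * arrow K f := by
  rw [arrow, ofPath_mul_ofPath, mulPath_of_eq, Quiver.Hom.toPath, Quiver.Path.comp_cons,
    Quiver.Path.comp_nil]

variable {S : Type*} [Ring S]

/-- The product of the weights of the arrows of a path. -/
def weight (w : ∀ ⦃a b : V⦄, (a ⟶ b) → S) {a : V} : ∀ {b : V}, Quiver.Path a b → S
  | _, .nil => 1
  | _, .cons p f => weight w p * w f

theorem weight_comp (w : ∀ ⦃a b : V⦄, (a ⟶ b) → S) {a b c : V} (p : Quiver.Path a b)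
    (q : Quiver.Path b c) : weight w (p.comp q) = weight w p * weight w q := by
  induction q with
  | nil => simp [weight]
  | cons q f ih => rw [Quiver.Path.comp_cons, weight, weight, ih, mul_assoc]

variable [Fintype V] [DecidableEq V] [Algebra K S]

/-- The matrix representation of the path algebra given by weights of the arrows. -/
def toMatrix (w : ∀ ⦃a b : V⦄, (a ⟶ b) → S) : PathAlgebra K V →ₐ[K] Matrix V V S :=
  AlgHom.ofLinearMap (extend fun p => Matrix.single p.1 p.2.1 (weight w p.2.2))
    (by
      rw [one_def, map_sum, ← Matrix.sum_single_one]
      simp only [vertex, extend_ofPath, weight])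
    (by
      intro x y
      refine induction x (by simp) (fun x₁ x₂ h₁ h₂ => by simp only [add_mul, map_add, h₁, h₂])
        fun c p => ?_
      refine induction y (by simp) (fun x₁ x₂ h₁ h₂ => by simp only [mul_add, map_add, h₁, h₂])
        fun d r => ?_
      rw [smul_mul, mul_smul', map_smul, map_smul, map_smul, map_smul, smul_mul_smul_comm,
        ← smul_smul]
      congr 2
      obtain ⟨a, b, p⟩ := p
      obtain ⟨a', b', r⟩ := r
      rw [ofPath_mul_ofPath, extend_ofPath, extend_ofPath]
      by_cases h : b = a'
      · subst h
        rw [mulPath_of_eq, extend_ofPath, weight_comp, Matrix.single_mul_single_same]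
      · rw [mulPath_of_ne h, map_zero, Matrix.single_mul_single_of_ne _ _ _ _ h])

theorem toMatrix_ofPath (w : ∀ ⦃a b : V⦄, (a ⟶ b) → S) {a b : V} (p : Quiver.Path a b) :
    toMatrix w (ofPath K ⟨a, b, p⟩) = Matrix.single a b (weight w p) :=
  extend_ofPath _ _

theorem toMatrix_vertex (w : ∀ ⦃a b : V⦄, (a ⟶ b) → S) (v : V) :
    toMatrix w (vertex K v) = Matrix.single v v 1 :=
  toMatrix_ofPath w _

theorem toMatrix_arrow (w : ∀ ⦃a b : V⦄, (a ⟶ b) → S) {a b : V} (f : a ⟶ b) :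
    toMatrix w (arrow K f) = Matrix.single a b (w f) := by
  rw [arrow, toMatrix_ofPath, Quiver.Hom.toPath, weight, weight, one_mul]

end

end PathAlgebra

/-! ### The monomial basis of `A₀(q₀, q₁, q₂, q₃)` -/

namespace GammaVertex

theorem mod2_add_one (m : GammaVertex) : (m + 1).mod2 = m.mod2 + 1 := by
  revert m; decide

theorem eq_mod2_or (m : GammaVertex) (l : ZMod 2) : l = m.mod2 ∨ l = m.mod2 + 1 := by
  revert m l; decide

end GammaVertex

theorem zmod_two_add_one_add_one (l : ZMod 2) : l + 1 + 1 = l := by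
  revert l; decide

theorem zmod_two_add_one_ne (l : ZMod 2) : l + 1 ≠ l := by
  revert l; decide

namespace GammaAlgebra

noncomputable section

open PathAlgebra

/-- The arrow `a_{l,m}` in the path algebra. -/
def pathArrow (K : Type u) [Field K] (l : ZMod 2) (m : GammaVertex) : PathAlgebra K GammaVertex :=
  arrow K (V := GammaVertex) (w := m + 1) (GammaArrow.a l m)

/-! ### Products of arrows in the path algebra -/

section Path

variable {K : Type u} [Field K]

theorem gammaX_eq (l : ZMod 2) : gammaX K l = ∑ m, pathArrow K l m := rfl

theorem gammaE_mul_gammaE (i j : GammaVertex) :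
    gammaE K i * gammaE K j = if i = j then gammaE K i else 0 := by
  split_ifs with h
  · subst h
    exact vertex_mul_ofPath _
  · exact vertex_mul_ofPath_of_ne h _

theorem gammaE_mul_pathArrow (i : GammaVertex) (l : ZMod 2) (m : GammaVertex) :
    gammaE K i * pathArrow K l m = if m = i then pathArrow K l m else 0 := by
  split_ifs with h
  · subst h
    exact vertex_mul_ofPath _
  · exact vertex_mul_ofPath_of_ne (Ne.symm h) _

theorem pathArrow_mul_gammaE (i : GammaVertex) (l : ZMod 2) (m : GammaVertex) :
    pathArrow K l m * gammaE K i = if m + 1 = i then pathArrow K l m else 0 := by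
  split_ifs with h
  · subst h
    exact ofPath_mul_vertex _
  · exact ofPath_mul_vertex_of_ne h _

/-- A linear combination of arrows, with one arrow at each vertex. -/
def arrowSum (c : GammaVertex → K) (s : GammaVertex → ZMod 2) : PathAlgebra K GammaVertex :=
  ∑ m, c m • pathArrow K (s m) m

theorem gammaE_mul_arrowSum (c : GammaVertex → K) (s : GammaVertex → ZMod 2) (i : GammaVertex) :
    gammaE K i * arrowSum c s = c i • pathArrow K (s i) i := by
  simp [arrowSum, Finset.mul_sum, gammaE_mul_pathArrow]

theorem arrowSum_mul_gammaE (c : GammaVertex → K) (s : GammaVertex → ZMod 2) (i : GammaVertex) :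
    arrowSum c s * gammaE K (i + 1) = c i • pathArrow K (s i) i := by
  simp [arrowSum, Finset.sum_mul, pathArrow_mul_gammaE]

theorem pathArrow_mul_arrowSum (c : GammaVertex → K) (s : GammaVertex → ZMod 2) (l : ZMod 2)
    (i : GammaVertex) :
    pathArrow K l i * arrowSum c s =
      c (i + 1) • (pathArrow K l i * pathArrow K (s (i + 1)) (i + 1)) := by
  have h : pathArrow K l i = pathArrow K l i * gammaE K (i + 1) := by
    rw [pathArrow_mul_gammaE, if_pos rfl]
  conv_lhs => rw [h]
  rw [mul_assoc, gammaE_mul_arrowSum, mul_smul_comm]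

theorem gammaE_mul_arrowSum_mul_arrowSum (c d : GammaVertex → K) (s t : GammaVertex → ZMod 2)
    (i : GammaVertex) :
    gammaE K i * (arrowSum c s * arrowSum d t) =
      (c i * d (i + 1)) • (pathArrow K (s i) i * pathArrow K (t (i + 1)) (i + 1)) := by
  rw [← mul_assoc, gammaE_mul_arrowSum, smul_mul_assoc, pathArrow_mul_arrowSum, smul_smul]

theorem gammaX_eq_arrowSum (l : ZMod 2) : gammaX K l = arrowSum (fun _ => 1) fun _ => l := by
  simp only [gammaX_eq, arrowSum, one_smul]

theorem gammaE_mul_gammaX_mul_gammaX (l k : ZMod 2) (i : GammaVertex) :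
    gammaE K i * (gammaX K l * gammaX K k) = pathArrow K l i * pathArrow K k (i + 1) := by
  rw [gammaX_eq_arrowSum, gammaX_eq_arrowSum, gammaE_mul_arrowSum_mul_arrowSum, one_mul, one_smul]

theorem gammaX_mul_gammaX (l k : ZMod 2) :
    gammaX K l * gammaX K k = ∑ i, pathArrow K l i * pathArrow K k (i + 1) := by
  rw [← one_mul (gammaX K l * gammaX K k), one_def, Finset.sum_mul]
  exact Finset.sum_congr rfl fun i _ => gammaE_mul_gammaX_mul_gammaX l k i

end Path

/-! ### The quantum relations and the spanning monomials -/

section Quotient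

variable {K : Type u} [Field K] {B : Type*} [Ring B] [Algebra K B]
  {π : PathAlgebra K GammaVertex →ₐ[K] B} {q : GammaVertex → K}

/-- Multiplying a relation on the left by e_i isolates the paths of length two starting at i. -/
theorem map_pathArrow_mul_pathArrow
    (hπ : ∀ r ∈ gammaRelations 0 q, π r = 0) (l : ZMod 2) (i : GammaVertex) :
    π (pathArrow K l i * pathArrow K (l + 1) (i + 1)) = 0 := by
  rw [← gammaE_mul_gammaX_mul_gammaX, map_mul, hπ _ (Or.inl ⟨l, rfl⟩), mul_zero]

theorem map_pathArrow_mul_pathArrow_mod2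
    (hπ : ∀ r ∈ gammaRelations 0 q, π r = 0) (i : GammaVertex) :
    π (pathArrow K (i.mod2 + 1) i * pathArrow K (i.mod2 + 1) (i + 1)) =
      -(q i • π (pathArrow K i.mod2 i * pathArrow K i.mod2 (i + 1))) := by
  have h := hπ _ (Or.inr ⟨i, rfl⟩)
  rw [mul_zero, zero_add, pow_two, pow_two, mul_add, mul_smul_comm, gammaE_mul_gammaX_mul_gammaX,
    gammaE_mul_gammaX_mul_gammaX, map_add, map_smul] at h
  exact eq_neg_of_add_eq_zero_right h

theorem map_ext {x y : PathAlgebra K GammaVertex}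
    (h : ∀ i, π (gammaE K i * x) = π (gammaE K i * y)) : π x = π y := by
  rw [← one_mul x, ← one_mul y, one_def, Finset.sum_mul, Finset.sum_mul, map_sum, map_sum]
  exact Finset.sum_congr rfl fun i _ => h i

/-- The element of `B` that is `c_i x_i` at the vertex `e_i`. -/
def genU (π : PathAlgebra K GammaVertex →ₐ[K] B) (c : GammaVertex → K) : B := π (arrowSum c fun i => i.mod2)

/-- The element of `B` that is `x_{i+1}` at the vertex `e_i`. -/
def genV (π : PathAlgebra K GammaVertex →ₐ[K] B) : B :=
  π (arrowSum (fun _ => 1) fun i => i.mod2 + 1)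

/-- The label used by `genU` alternates with the vertex, so consecutive arrows have different labels
and their product is a relation. -/
theorem genU_mul_genU
    (hπ : ∀ r ∈ gammaRelations 0 q, π r = 0) (c : GammaVertex → K) : genU π c * genU π c = 0 := by
  rw [genU, ← map_mul, ← map_zero (π)]
  refine map_ext fun i => ?_
  rw [gammaE_mul_arrowSum_mul_arrowSum, map_smul, GammaVertex.mod2_add_one,
    map_pathArrow_mul_pathArrow hπ, smul_zero, mul_zero, map_zero]

theorem genV_mul_genV
    (hπ : ∀ r ∈ gammaRelations 0 q, π r = 0) : genV π * genV π = 0 := by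
  rw [genV, ← map_mul, ← map_zero (π)]
  refine map_ext fun i => ?_
  rw [gammaE_mul_arrowSum_mul_arrowSum, map_smul, GammaVertex.mod2_add_one,
    map_pathArrow_mul_pathArrow hπ, smul_zero, mul_zero, map_zero]

/-- At the vertex i the product vu is c(i+1) times the path with label i+1, which the relation turns
into -c(i+1) q_i times the path with label i, whereas uv is c(i) times that path. The recurrence
`hc` makes the ratio independent of i. -/
theorem genV_mul_genU
    (hπ : ∀ r ∈ gammaRelations 0 q, π r = 0) {c : GammaVertex → K} {ρ : K} (hc : ∀ i, c (i + 1) * q i = ρ * c i) :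
    genV π * genU π c = -(ρ • (genU π c * genV π)) := by
  rw [genU, genV, ← map_mul, ← map_mul, ← map_smul, ← map_neg]
  refine map_ext fun i => ?_
  rw [mul_neg, mul_smul_comm, gammaE_mul_arrowSum_mul_arrowSum, gammaE_mul_arrowSum_mul_arrowSum,
    map_smul, map_neg, map_smul, map_smul, GammaVertex.mod2_add_one, zmod_two_add_one_add_one,
    map_pathArrow_mul_pathArrow_mod2 hπ, smul_neg, smul_smul, smul_smul, one_mul, mul_one, hc]

theorem map_gammaE_mul_arrowSum (c : GammaVertex → K) (s : GammaVertex → ZMod 2)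
    (i : GammaVertex) :
    π (gammaE K i) * π (arrowSum c s) =
      π (arrowSum c s) * π (gammaE K (i + 1)) := by
  rw [← map_mul, ← map_mul, gammaE_mul_arrowSum, arrowSum_mul_gammaE]

/-- The four monomials `1`, `u`, `v`, `uv`. -/
def monomials (π : PathAlgebra K GammaVertex →ₐ[K] B) (c : GammaVertex → K) : Fin 4 → B :=
  ![1, genU π c, genV π, genU π c * genV π]

/-- The family of the elements `e_i`, `e_i u`, `e_i v`, `e_i u v`. -/
def monomialFamily (π : PathAlgebra K GammaVertex →ₐ[K] B) (c : GammaVertex → K) (p : GammaVertex × Fin 4) : B :=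
  π (gammaE K p.1) * monomials π c p.2

/-- An idempotent can be moved to the left through a monomial with its index shifted; there it is
absorbed by the initial idempotent or annihilates it. -/
theorem monomialFamily_mul_gammaE (c : GammaVertex → K) (p : GammaVertex × Fin 4)
    (j : GammaVertex) :
    monomialFamily π c p * π (gammaE K j) ∈
      Submodule.span K (Set.range (monomialFamily π c)) := by
  have key : ∃ k : GammaVertex, monomialFamily π c p * π (gammaE K j) =
      π (gammaE K p.1) * π (gammaE K k) * monomials π c p.2 := by
    have hs : ∀ (d : GammaVertex → K) (s : GammaVertex → ZMod 2) (k : GammaVertex),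
        π (arrowSum d s) * π (gammaE K k) =
          π (gammaE K (k - 1)) * π (arrowSum d s) := fun d s k => by
      rw [map_gammaE_mul_arrowSum, sub_add_cancel]
    obtain ⟨i, m⟩ := p
    fin_cases m
    · exact ⟨j, by simp [monomialFamily, monomials]⟩
    · exact ⟨j - 1, by simp [monomialFamily, monomials, genU, mul_assoc, hs]⟩
    · exact ⟨j - 1, by simp [monomialFamily, monomials, genV, mul_assoc, hs]⟩
    · refine ⟨j - 1 - 1, ?_⟩
      change π (gammaE K i) * (genU π c * genV π) * _ = _ * _ * (genU π c * genV π)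
      rw [genU, genV, mul_assoc, mul_assoc, hs, ← mul_assoc (π (arrowSum _ _)), hs]
      simp only [mul_assoc]
  obtain ⟨k, hk⟩ := key
  rw [hk, ← map_mul, gammaE_mul_gammaE]
  split_ifs
  · exact Submodule.subset_span ⟨p, rfl⟩
  · rw [map_zero, zero_mul]
    exact Submodule.zero_mem _

theorem monomialFamily_mul_genU
    (hπ : ∀ r ∈ gammaRelations 0 q, π r = 0) {c : GammaVertex → K} {ρ : K}
    (hc : ∀ i, c (i + 1) * q i = ρ * c i) (p : GammaVertex × Fin 4) :
    monomialFamily π c p * genU π c ∈ Submodule.span K (Set.range (monomialFamily π c)) := by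
  obtain ⟨i, m⟩ := p
  rw [monomialFamily, mul_assoc]
  fin_cases m
  · exact Submodule.subset_span ⟨(i, 1), by simp [monomialFamily, monomials]⟩
  · simp [monomials, genU_mul_genU hπ]
  · have h : π (gammaE K i) * (genV π * genU π c) = (-ρ) • monomialFamily π c (i, 3) := by
      rw [genV_mul_genU hπ hc, mul_neg, mul_smul_comm, neg_smul]
      rfl
    change π (gammaE K i) * (genV π * genU π c) ∈ _
    rw [h]
    exact Submodule.smul_mem _ _ (Submodule.subset_span ⟨(i, 3), rfl⟩)
  · have h : genU π c * genV π * genU π c = 0 := by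
      rw [mul_assoc, genV_mul_genU hπ hc, mul_neg, mul_smul_comm, ← mul_assoc, genU_mul_genU hπ,
        zero_mul, smul_zero, neg_zero]
    simp [monomials, h]

theorem monomialFamily_mul_genV
    (hπ : ∀ r ∈ gammaRelations 0 q, π r = 0) (c : GammaVertex → K) (p : GammaVertex × Fin 4) :
    monomialFamily π c p * genV π ∈ Submodule.span K (Set.range (monomialFamily π c)) := by
  obtain ⟨i, m⟩ := p
  rw [monomialFamily, mul_assoc]
  fin_cases m
  · exact Submodule.subset_span ⟨(i, 2), by simp [monomialFamily, monomials]⟩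
  · exact Submodule.subset_span ⟨(i, 3), by simp [monomialFamily, monomials]⟩
  · simp [monomials, genV_mul_genV hπ]
  · simp [monomials, mul_assoc, genV_mul_genV hπ]

theorem span_mul_mem {R ι : Type*} [Ring R] [Algebra K R] {f : ι → R} {y : R}
    (h : ∀ i, f i * y ∈ Submodule.span K (Set.range f)) {x : R}
    (hx : x ∈ Submodule.span K (Set.range f)) : x * y ∈ Submodule.span K (Set.range f) := by
  induction hx using Submodule.span_induction with
  | mem x hx => obtain ⟨i, rfl⟩ := hx; exact h i
  | zero => rw [zero_mul]; exact Submodule.zero_mem _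
  | add x y _ _ h₁ h₂ => rw [add_mul]; exact Submodule.add_mem _ h₁ h₂
  | smul a x _ h => rw [smul_mul_assoc]; exact Submodule.smul_mem _ _ h

theorem map_pathArrow_mod2 {c : GammaVertex → K} {i : GammaVertex} (hi : c i ≠ 0) :
    π (pathArrow K i.mod2 i) = (c i)⁻¹ • (π (gammaE K i) * genU π c) := by
  rw [genU, ← map_mul, gammaE_mul_arrowSum, map_smul, inv_smul_smul₀ hi]

theorem map_pathArrow_mod2_add_one (i : GammaVertex) :
    π (pathArrow K (i.mod2 + 1) i) = π (gammaE K i) * genV π := by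
  rw [genV, ← map_mul, gammaE_mul_arrowSum, one_smul]

/-- The span is stable under right multiplication by e_m, u and v, and every arrow is e_m u or e_m v
up to a nonzero scalar; induct on the path. -/
theorem map_ofPath_mem_span
    (hπ : ∀ r ∈ gammaRelations 0 q, π r = 0) {c : GammaVertex → K} {ρ : K} (hc₀ : ∀ i, c i ≠ 0)
    (hc : ∀ i, c (i + 1) * q i = ρ * c i) {a b : GammaVertex} (p : Quiver.Path a b) :
    π (ofPath K ⟨a, b, p⟩) ∈ Submodule.span K (Set.range (monomialFamily π c)) := by
  induction p with
  | nil => exact Submodule.subset_span ⟨(a, 0), mul_one _⟩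
  | @cons m _ p f ih =>
    rw [ofPath_cons, map_mul]
    rcases f with ⟨l⟩
    change _ * π (pathArrow K l m) ∈ _
    have hE := span_mul_mem (fun p => monomialFamily_mul_gammaE c p m) ih
    obtain rfl | rfl := GammaVertex.eq_mod2_or m l
    · rw [map_pathArrow_mod2 (hc₀ m), mul_smul_comm, ← mul_assoc]
      exact Submodule.smul_mem _ _ (span_mul_mem (monomialFamily_mul_genU hπ hc) hE)
    · rw [map_pathArrow_mod2_add_one, ← mul_assoc]
      exact span_mul_mem (monomialFamily_mul_genV hπ c) hE

theorem span_monomialFamily (hπ' : Function.Surjective π)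
    (hπ : ∀ r ∈ gammaRelations 0 q, π r = 0) {c : GammaVertex → K} {ρ : K} (hc₀ : ∀ i, c i ≠ 0)
    (hc : ∀ i, c (i + 1) * q i = ρ * c i) :
    ⊤ ≤ Submodule.span K (Set.range (monomialFamily π c)) := by
  intro x _
  obtain ⟨x, rfl⟩ := hπ' x
  refine PathAlgebra.induction x ?_ (fun x y hx hy => ?_) fun a p => ?_
  · rw [map_zero]
    exact Submodule.zero_mem _
  · rw [map_add]
    exact Submodule.add_mem _ hx hy
  · rw [map_smul]
    exact Submodule.smul_mem _ _ (map_ofPath_mem_span hπ hc₀ hc p.2.2)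

theorem map_gammaE_mul_gammaE (i j : GammaVertex) :
    π (gammaE K i) * π (gammaE K j) = if i = j then π (gammaE K i) else 0 := by
  rw [← map_mul, gammaE_mul_gammaE]
  split_ifs
  · rfl
  · exact map_zero π

theorem sum_map_gammaE : ∑ i, π (gammaE K i) = 1 := by
  rw [← map_sum, ← map_one π, one_def]

end Quotient

/-! ### A matrix representation separating the monomials -/

section Representation

variable {K : Type u} [Field K]

/-- Right multiplication by `u` on the quantum plane modulo `u²`, `v²`, in the basis
`1`, `u`, `v`, `uv`. -/
def planeU (ρ : K) : Matrix (Fin 4) (Fin 4) K := !![0, 1, 0, 0; 0, 0, 0, 0; 0, 0, 0, -ρ; 0, 0, 0, 0]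

/-- Right multiplication by `v` on the quantum plane modulo `u²`, `v²`, in the basis
`1`, `u`, `v`, `uv`. -/
def planeV (K : Type u) [Field K] : Matrix (Fin 4) (Fin 4) K :=
  !![0, 0, 1, 0; 0, 0, 0, 1; 0, 0, 0, 0; 0, 0, 0, 0]

theorem planeU_mul_planeU (ρ : K) : planeU ρ * planeU ρ = 0 := by
  ext i j
  fin_cases i <;> fin_cases j <;> simp [planeU, Matrix.mul_apply, Fin.sum_univ_four]

theorem planeV_mul_planeV : planeV K * planeV K = 0 := by
  ext i j
  fin_cases i <;> fin_cases j <;> simp [planeV, Matrix.mul_apply, Fin.sum_univ_four]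

theorem planeV_mul_planeU (ρ : K) : planeV K * planeU ρ = -(ρ • (planeU ρ * planeV K)) := by
  ext i j
  fin_cases i <;> fin_cases j <;> simp [planeU, planeV, Matrix.mul_apply, Fin.sum_univ_four]

/-- The action of the arrow `a_{l,m}` on the quantum plane. -/
def arrowWeight (c : GammaVertex → K) (ρ : K) (l : ZMod 2) (m : GammaVertex) :
    Matrix (Fin 4) (Fin 4) K :=
  if l = m.mod2 then (c m)⁻¹ • planeU ρ else planeV K

/-- The representation of the path algebra on four copies of the quantum plane. -/
def planeRep (c : GammaVertex → K) (ρ : K) :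
    PathAlgebra K GammaVertex →ₐ[K] Matrix GammaVertex GammaVertex (Matrix (Fin 4) (Fin 4) K) :=
  toMatrix fun _ _ f => GammaArrow.casesOn f fun l m => arrowWeight c ρ l m

theorem planeRep_gammaE (c : GammaVertex → K) (ρ : K) (i : GammaVertex) :
    planeRep c ρ (gammaE K i) = Matrix.single i i 1 :=
  toMatrix_vertex _ _

theorem planeRep_pathArrow (c : GammaVertex → K) (ρ : K) (l : ZMod 2) (m : GammaVertex) :
    planeRep c ρ (pathArrow K l m) = Matrix.single m (m + 1) (arrowWeight c ρ l m) :=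
  toMatrix_arrow _ _

theorem arrowWeight_mod2 (c : GammaVertex → K) (ρ : K) (m : GammaVertex) :
    arrowWeight c ρ m.mod2 m = (c m)⁻¹ • planeU ρ := if_pos rfl

theorem arrowWeight_mod2_add_one (c : GammaVertex → K) (ρ : K) (m : GammaVertex) :
    arrowWeight c ρ (m.mod2 + 1) m = planeV K := if_neg (zmod_two_add_one_ne _)

theorem arrowWeight_succ (c : GammaVertex → K) (ρ : K) (m : GammaVertex) :
    arrowWeight c ρ (m.mod2 + 1) (m + 1) = (c (m + 1))⁻¹ • planeU ρ := by
  rw [← GammaVertex.mod2_add_one, arrowWeight_mod2]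

theorem arrowWeight_mod2_succ (c : GammaVertex → K) (ρ : K) (m : GammaVertex) :
    arrowWeight c ρ m.mod2 (m + 1) = planeV K := by
  rw [← zmod_two_add_one_add_one m.mod2, ← GammaVertex.mod2_add_one, arrowWeight_mod2_add_one]

theorem arrowWeight_mul_arrowWeight (c : GammaVertex → K) (ρ : K) (l : ZMod 2) (m : GammaVertex) :
    arrowWeight c ρ l m * arrowWeight c ρ (l + 1) (m + 1) = 0 := by
  obtain rfl | rfl := GammaVertex.eq_mod2_or m l
  · rw [arrowWeight_mod2, arrowWeight_succ, smul_mul_smul_comm, planeU_mul_planeU, smul_zero]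
  · rw [arrowWeight_mod2_add_one, zmod_two_add_one_add_one, arrowWeight_mod2_succ,
      planeV_mul_planeV]

theorem planeRep_eq_zero_of_mem {q c : GammaVertex → K} {ρ : K} (hc₀ : ∀ i, c i ≠ 0)
    (hc : ∀ i, c (i + 1) * q i = ρ * c i) {r : PathAlgebra K GammaVertex}
    (hr : r ∈ gammaRelations 0 q) : planeRep c ρ r = 0 := by
  obtain ⟨l, rfl⟩ | ⟨i, rfl⟩ := hr
  · rw [gammaX_mul_gammaX, map_sum]
    refine Finset.sum_eq_zero fun i _ => ?_
    rw [map_mul, planeRep_pathArrow, planeRep_pathArrow, Matrix.single_mul_single_same,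
      arrowWeight_mul_arrowWeight, Matrix.single_zero]
  · have h : q i * (c i)⁻¹ - (c (i + 1))⁻¹ * ρ = 0 := by
      have h₁ := hc₀ i
      have h₂ := hc₀ (i + 1)
      field_simp
      linear_combination hc i
    rw [mul_zero, zero_add, pow_two, pow_two, mul_add, mul_smul_comm,
      gammaE_mul_gammaX_mul_gammaX, gammaE_mul_gammaX_mul_gammaX, map_add, map_smul, map_mul,
      map_mul, planeRep_pathArrow, planeRep_pathArrow, planeRep_pathArrow, planeRep_pathArrow,
      Matrix.single_mul_single_same, Matrix.single_mul_single_same, arrowWeight_mod2,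
      arrowWeight_mod2_succ, arrowWeight_mod2_add_one, arrowWeight_succ, Matrix.smul_single,
      ← Matrix.single_add, mul_smul_comm, smul_mul_assoc, planeV_mul_planeU, smul_neg, smul_smul,
      smul_smul, ← sub_eq_add_neg, ← sub_smul, h, zero_smul, Matrix.single_zero]

theorem planeRep_arrowSum (c : GammaVertex → K) (ρ : K) (d : GammaVertex → K)
    (s : GammaVertex → ZMod 2) :
    planeRep c ρ (arrowSum d s) =
      ∑ m, Matrix.single m (m + 1) (d m • arrowWeight c ρ (s m) m) := by
  simp only [arrowSum, map_sum, map_smul, planeRep_pathArrow, Matrix.smul_single]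

theorem planeRep_arrowSum_mod2 {c : GammaVertex → K} (ρ : K) (hc₀ : ∀ i, c i ≠ 0) :
    planeRep c ρ (arrowSum c fun i => i.mod2) = ∑ m, Matrix.single m (m + 1) (planeU ρ) := by
  simp only [planeRep_arrowSum, arrowWeight_mod2, smul_smul, mul_inv_cancel₀ (hc₀ _), one_smul]

theorem planeRep_arrowSum_mod2_add_one (c : GammaVertex → K) (ρ : K) :
    planeRep c ρ (arrowSum (fun _ => 1) fun i => i.mod2 + 1) =
      ∑ m, Matrix.single m (m + 1) (planeV K) := by
  simp only [planeRep_arrowSum, arrowWeight_mod2_add_one, one_smul]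

theorem single_mul_sum_single {S : Type*} [Ring S] (i j : GammaVertex) (x y : S) :
    Matrix.single i j x * ∑ m, Matrix.single m (m + 1) y = Matrix.single i (j + 1) (x * y) := by
  rw [Finset.mul_sum, Finset.sum_eq_single j]
  · rw [Matrix.single_mul_single_same]
  · intro m _ hm
    rw [Matrix.single_mul_single_of_ne _ _ _ _ hm.symm]
  · simp

/-- The lift to the path algebra of the family `monomialFamily`. -/
def pathMonomial (c : GammaVertex → K) (p : GammaVertex × Fin 4) : PathAlgebra K GammaVertex :=
  gammaE K p.1 * (![1, arrowSum c fun i => i.mod2, arrowSum (fun _ => 1) fun i => i.mod2 + 1,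
    (arrowSum c fun i => i.mod2) * arrowSum (fun _ => 1) fun i => i.mod2 + 1] :
      Fin 4 → PathAlgebra K GammaVertex) p.2

theorem map_pathMonomial {B : Type*} [Ring B] [Algebra K B]
    (π : PathAlgebra K GammaVertex →ₐ[K] B) (c : GammaVertex → K) (p : GammaVertex × Fin 4) :
    π (pathMonomial c p) = monomialFamily π c p := by
  obtain ⟨i, m⟩ := p
  fin_cases m <;> simp [pathMonomial, monomialFamily, monomials, genU, genV]

/-- The degrees of the monomials `1`, `u`, `v`, `uv`. -/
def monomialDegree : Fin 4 → GammaVertex := ![0, 1, 1, 2]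

theorem planeRep_pathMonomial {c : GammaVertex → K} (ρ : K) (hc₀ : ∀ i, c i ≠ 0)
    (p : GammaVertex × Fin 4) :
    planeRep c ρ (pathMonomial c p) =
      Matrix.single p.1 (p.1 + monomialDegree p.2)
        ((![1, planeU ρ, planeV K, planeU ρ * planeV K] : Fin 4 → Matrix (Fin 4) (Fin 4) K) p.2) := by
  obtain ⟨i, m⟩ := p
  rw [pathMonomial, map_mul, planeRep_gammaE]
  fin_cases m
  · simp [monomialDegree]
  · simp [monomialDegree, planeRep_arrowSum_mod2 ρ hc₀, single_mul_sum_single]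
  · simp [monomialDegree, planeRep_arrowSum_mod2_add_one, single_mul_sum_single]
  · simp [monomialDegree, planeRep_arrowSum_mod2 ρ hc₀, planeRep_arrowSum_mod2_add_one,
      ← mul_assoc, single_mul_sum_single, add_assoc, one_add_one_eq_two]

/-- Row 0 of the matrix of right multiplication by a monomial is the monomial itself, and the outer
block records its end vertices. These entries therefore form a dual family. -/
theorem planeRep_pathMonomial_apply {c : GammaVertex → K} (ρ : K) (hc₀ : ∀ i, c i ≠ 0)
    (p r : GammaVertex × Fin 4) :
    planeRep c ρ (pathMonomial c p) r.1 (r.1 + monomialDegree r.2) 0 r.2 =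
      if p = r then 1 else 0 := by
  obtain ⟨i, m⟩ := p
  obtain ⟨j, n⟩ := r
  rw [planeRep_pathMonomial ρ hc₀]
  by_cases hij : i = j
  · subst hij
    by_cases hd : monomialDegree m = monomialDegree n
    · simp only [hd, Matrix.single_apply_same, Prod.mk.injEq, true_and]
      fin_cases m <;> fin_cases n <;>
        simp [planeU, planeV]
    · have hmn : m ≠ n := fun h => hd (h ▸ rfl)
      simp [Matrix.single_apply_of_ne, hd, hmn]
  · simp [hij]

end Representation

/-! ### The quotient algebra as a quantum cover -/

section Basis

variable {K : Type u} [Field K] {q c : GammaVertex → K} {ρ : K}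

variable (q) in
/-- The projection of the path algebra onto `A₀(q₀, q₁, q₂, q₃)`. -/
def proj : PathAlgebra K GammaVertex →ₐ[K] GammaAlgebra 0 q :=
  (TwoSidedIdeal.span (gammaRelations 0 q)).ringCon.mkₐ K

theorem proj_surjective : Function.Surjective (proj q) :=
  RingCon.mkₐ_surjective (α := K) (TwoSidedIdeal.span (gammaRelations 0 q)).ringCon

theorem proj_eq_zero_of_mem (r : PathAlgebra K GammaVertex) (h : r ∈ gammaRelations 0 q) :
    proj q r = 0 :=
  (RingCon.eq _).2 (TwoSidedIdeal.subset_span h)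

/-- The representation of `A₀(q₀, q₁, q₂, q₃)` induced by `planeRep`. -/
def quotientRep (hc₀ : ∀ i, c i ≠ 0) (hc : ∀ i, c (i + 1) * q i = ρ * c i) :
    GammaAlgebra 0 q →ₐ[K] Matrix GammaVertex GammaVertex (Matrix (Fin 4) (Fin 4) K) :=
  RingCon.liftₐ _ (planeRep c ρ) fun x y h => by
    have hle : TwoSidedIdeal.span (gammaRelations 0 q) ≤ TwoSidedIdeal.ker (planeRep c ρ) :=
      TwoSidedIdeal.span_le.2 fun r hr =>
        (TwoSidedIdeal.mem_ker _).2 (planeRep_eq_zero_of_mem hc₀ hc hr)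
    exact TwoSidedIdeal.ringCon_le_iff.1 hle h

theorem quotientRep_proj (hc₀ : ∀ i, c i ≠ 0) (hc : ∀ i, c (i + 1) * q i = ρ * c i)
    (x : PathAlgebra K GammaVertex) : quotientRep hc₀ hc (proj q x) = planeRep c ρ x :=
  rfl

theorem linearIndependent_monomialFamily (hc₀ : ∀ i, c i ≠ 0)
    (hc : ∀ i, c (i + 1) * q i = ρ * c i) :
    LinearIndependent K (monomialFamily (proj q) c) := by
  have h : ∀ p r : GammaVertex × Fin 4,
      quotientRep hc₀ hc (monomialFamily (proj q) c p) r.1 (r.1 + monomialDegree r.2) 0 r.2 =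
        if p = r then 1 else 0 := fun p r => by
    rw [← map_pathMonomial, quotientRep_proj, planeRep_pathMonomial_apply ρ hc₀]
  refine LinearIndependent.of_pairwise_dual_eq_zero_one _
    (fun r => (Matrix.entryLinearMap K K 0 r.2) ∘ₗ
      (Matrix.entryLinearMap K (Matrix (Fin 4) (Fin 4) K) r.1 (r.1 + monomialDegree r.2)) ∘ₗ
        (quotientRep hc₀ hc).toLinearMap) ?_ ?_
  · intro r p hrp
    exact (h p r).trans (if_neg hrp.symm)
  · intro r
    exact (h r r).trans (if_pos rfl)

/-- The algebra `A₀(q₀, q₁, q₂, q₃)` is a cover of the quantum plane modulo squares. -/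
def quantumCover (hc₀ : ∀ i, c i ≠ 0) (hc : ∀ i, c (i + 1) * q i = ρ * c i) :
    QuantumCover K (GammaAlgebra 0 q) ρ where
  e i := proj q (gammaE K i)
  u := genU (proj q) c
  v := genV (proj q)
  basis := Module.Basis.mk (linearIndependent_monomialFamily hc₀ hc)
    (span_monomialFamily proj_surjective proj_eq_zero_of_mem hc₀ hc)
  e_mul_e := map_gammaE_mul_gammaE
  sum_e := sum_map_gammaE
  e_mul_u := map_gammaE_mul_arrowSum _ _
  e_mul_v := map_gammaE_mul_arrowSum _ _
  u_mul_u := genU_mul_genU proj_eq_zero_of_mem c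
  v_mul_v := genV_mul_genV proj_eq_zero_of_mem
  v_mul_u := genV_mul_genU proj_eq_zero_of_mem hc
  basis_apply _ _ := Module.Basis.mk_apply _ _ _

end Basis

end

end GammaAlgebra

/-! ### The Hochschild cohomology ring of `A₀(q₀, q₁, q₂, q₃)` -/

namespace GammaAlgebra

/-- Start from c(0) = 1 and solve c(i+1) = ρ c(i) / q_i; returning to the vertex 0 forces ρ⁴ =
q₀q₁q₂q₃, solvable over an algebraically closed field. -/
theorem exists_rescaling {K : Type*} [Field K] [IsAlgClosed K] {q : GammaVertex → K}
    (hq : ∀ i, q i ≠ 0) :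
    ∃ (ρ : K) (c : GammaVertex → K), ρ ^ 4 = q 0 * q 1 * q 2 * q 3 ∧ (∀ i, c i ≠ 0) ∧
      ∀ i, c (i + 1) * q i = ρ * c i := by
  obtain ⟨ρ, hρ⟩ := IsAlgClosed.exists_pow_nat_eq (q 0 * q 1 * q 2 * q 3) (n := 4) (by norm_num)
  have h₀ := hq 0
  have h₁ := hq 1
  have h₂ := hq 2
  have h₃ := hq 3
  have hρ₀ : ρ ≠ 0 := by
    rintro rfl
    rw [zero_pow (by norm_num)] at hρ
    simp [h₀, h₁, h₂, h₃] at hρ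
  refine ⟨ρ, (![1, ρ / q 0, ρ ^ 2 / (q 0 * q 1), ρ ^ 3 / (q 0 * q 1 * q 2)] : Fin 4 → K), hρ,
    fun i => ?_, fun i => ?_⟩
  · change Fin 4 at i
    fin_cases i
    · exact one_ne_zero
    · exact div_ne_zero hρ₀ h₀
    · exact div_ne_zero (pow_ne_zero _ hρ₀) (mul_ne_zero h₀ h₁)
    · exact div_ne_zero (pow_ne_zero _ hρ₀) (mul_ne_zero (mul_ne_zero h₀ h₁) h₂)
  · change Fin 4 at i
    fin_cases i
    · change ρ / q 0 * q 0 = ρ * 1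
      field_simp
    · change ρ ^ 2 / (q 0 * q 1) * q 1 = ρ * (ρ / q 0)
      field_simp
    · change ρ ^ 3 / (q 0 * q 1 * q 2) * q 2 = ρ * (ρ ^ 2 / (q 0 * q 1))
      field_simp
    · change 1 * q 3 = ρ * (ρ ^ 3 / (q 0 * q 1 * q 2))
      field_simp
      rw [hρ]
      ring

end GammaAlgebra

theorem pow_injective_of_forall_pow_ne_one {K : Type*} [Field K] {x : K} (hx : x ≠ 0)
    (h : ∀ n : ℕ, 0 < n → x ^ n ≠ 1) : Function.Injective fun n : ℕ => x ^ n := by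
  have key : ∀ a b : ℕ, a < b → x ^ a ≠ x ^ b := fun a b hab heq => by
    refine h (b - a) (Nat.sub_pos_of_lt hab) (mul_left_cancel₀ (pow_ne_zero a hx) ?_)
    rw [← pow_add, Nat.add_sub_cancel' hab.le, mul_one, heq]
  intro a b hab
  by_contra hne
  obtain hlt | hlt := Nat.lt_or_gt_of_ne hne
  · exact key a b hlt hab
  · exact key b a hlt hab.symm

theorem corollary3p6 {K : Type u} [Field K] [IsAlgClosed K] (q : GammaVertex → K)
    (hq : ∀ i, q i ≠ 0) (hroot : ∀ n : ℕ, 0 < n → (q 0 * q 1 * q 2 * q 3) ^ n ≠ 1) :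
    Module.finrank K (HochschildRing K (GammaAlgebra 0 q)) = 4 ∧
    IsLocalRing (HochschildRing K (GammaAlgebra 0 q)) ∧
    Nonempty ((hochschildNilIdeal K (GammaAlgebra 0 q)).ringCon.Quotient ≃ₐ[K] K) := by
  obtain ⟨ρ, c, hρ, hc₀, hc⟩ := GammaAlgebra.exists_rescaling hq
  have hQ : q 0 * q 1 * q 2 * q 3 ≠ 0 :=
    mul_ne_zero (mul_ne_zero (mul_ne_zero (hq 0) (hq 1)) (hq 2)) (hq 3)
  -- The fourth power of ρ^a is (q₀q₁q₂q₃)^a, and distinct powers of an element that is not a root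
  -- of unity differ.
  have hρ' : ∀ a b : ℕ, a ≠ b → (ρ ^ a) ^ 4 ≠ (ρ ^ b) ^ 4 := fun a b hab heq => by
    refine hab (pow_injective_of_forall_pow_ne_one hQ hroot ?_)
    simpa only [← hρ, ← pow_mul, mul_comm 4] using heq
  let S := GammaAlgebra.quantumCover hc₀ hc
  have : Nontrivial (GammaAlgebra 0 q) := ⟨_, _, S.basis.ne_zero 0⟩
  let e₀ : HochschildCohomology K (GammaAlgebra 0 q) 0 ≃ₗ[K] K :=
    (LinearEquiv.ofBijective (LinearMap.toSpanSingleton K _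
      (HochschildCohomology.unit K (GammaAlgebra 0 q)))
      ⟨fun a b h => smul_left_injective K QuantumCover.unit_ne_zero h, fun α => by
        obtain ⟨a, ha⟩ := S.exists_eq_smul_unit α
        exact ⟨a, ha.symm⟩⟩).symm
  have he₀ : e₀ (HochschildCohomology.unit K (GammaAlgebra 0 q)) = 1 :=
    (LinearEquiv.symm_apply_eq _).2 (one_smul K _).symm
  have vanish : ∀ n, 3 ≤ n → Subsingleton (HochschildCohomology K (GammaAlgebra 0 q) n) :=
    fun n hn => S.subsingleton_hochschild hρ' hn
  obtain ⟨e₁⟩ := S.nonempty_hochschild_one hρ'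
  obtain ⟨e₂⟩ := S.nonempty_hochschild_two hρ'
  exact ⟨HochschildRing.finrank_eq_four e₀ e₁ e₂ vanish,
    HochschildRing.isLocalRing e₀ he₀ vanish,
    HochschildRing.nonempty_quotient_algEquiv e₀ he₀ vanish⟩
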